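/- Let $\alpha\in\mathbb{C}$ satisfy $7\alpha^3+7\alpha+1=0$. In homogeneous coordinates $(x:y:z:w)$ on $\mathbb{P}^3(\mathbb{C})$ put $$P := x\left[x^6-3\cdot 7\,x^4y^2+5\cdot 7\,x^2y^4-7y^6\right]+7z\left[(x^2+y^2)^3-2^3z^2(x^2+y^2)^2+2^4z^4(x^2+y^2)\right]-2^6z^7,$$ $$U_\alpha := (z+a_5w)\left((z+w)(x^2+y^2)+a_1z^3+a_2z^2w+a_3zw^2+a_4w^3\right)^2,$$ where $$a_1:=-\tfrac{12}{7}\alpha^2-\tfrac{384}{49}\alpha-\tfrac87,\quad a_2:=-\tfrac{32}{7}\alpha^2+\tfrac{24}{49}\alpha-4,\quad a_3:=-4\alpha^2+\tfrac{24}{49}\alpha-4,$$ $$a_4:=-\tfrac87\alpha^2+\tfrac{8}{49}\alpha-\tfrac87,\quad a_5:=49\alpha^2-7\alpha+50.$$ Then the surface $S_\alpha\subset\mathbb{P}^3(\mathbb{C})$ with equation $P-U_\alpha=0$ is a surface of degree $7$ whose equation is invariant under the dihedral group $D_7$ generated by $y\mapsto -y$ and the rotation of the $(x,y)$-plane by $2\pi/7$,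 and it has exactly $99$ ordinary double points and no other singularities. Moreover, the equation $7\alpha^3+7\alpha+1=0$ has exactly one real solution $\alpha_{\mathbb{R}}$; it satisfies $\alpha_{\mathbb{R}}\approx-0.14010685$ (to eight decimal places), and all the singularities of $S_{\alpha_{\mathbb{R}}}$ are real, i.e. each of the $99$ nodes is a point with real homogeneous coordinates. -/

import Mathlib

open MvPolynomial
open scoped LinearAlgebra.Projectivization

/-- The point `p` of projective space is a singular point of the hypersurface `F = 0`
(`F` a homogeneous polynomial): `F` and all its partial derivatives vanish at `p`.
For homogeneous `F` this does not depend on the chosen homogeneous coordinates `p.rep`. -/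
def IsSingularPoint {ι K : Type*} [Field K] (F : MvPolynomial ι K) (p : ℙ K (ι → K)) : Prop :=
  eval p.rep F = 0 ∧ ∀ j, eval p.rep (pderiv j F) = 0

/-- The equation of the hypersurface `F = 0` in the affine chart where the `i`-th homogeneous
coordinate is `1`. -/
noncomputable def dehomogenize {ι K : Type*} [DecidableEq ι] [Field K] (i : ι)
    (F : MvPolynomial ι K) : MvPolynomial {j : ι // j ≠ i} K :=
  aeval (fun j => if h : j = i then 1 else X ⟨j, h⟩) F

/-- The affine coordinates `p_j / p_i` (`j ≠ i`) of a point `p` with `p_i ≠ 0`. -/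
noncomputable def affineCoord {ι K : Type*} [Field K] (i : ι) (p : ℙ K (ι → K)) :
    {j : ι // j ≠ i} → K :=
  fun j => p.rep j / p.rep i

/-- The Hessian matrix of the polynomial `f` at the point `a`. -/
noncomputable def hessianAt {σ K : Type*} [Field K] (f : MvPolynomial σ K) (a : σ → K) :
    Matrix σ σ K :=
  Matrix.of fun j k => eval a (pderiv j (pderiv k f))

/-- An ordinary double point (node, `A₁`-singularity) of the hypersurface `F = 0`: a singular
point at which, in an affine chart containing it, the local equation of the hypersurface has a
nondegenerate quadratic part, i.e. an invertible Hessian matrix. -/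
def IsOrdinaryDoublePoint {ι K : Type*} [Fintype ι] [DecidableEq ι] [Field K]
    (F : MvPolynomial ι K) (p : ℙ K (ι → K)) : Prop :=
  IsSingularPoint F p ∧
    ∃ i, p.rep i ≠ 0 ∧ (hessianAt (dehomogenize i F) (affineCoord i p)).det ≠ 0

/-- A point of complex projective space is real if it has real homogeneous coordinates. -/
def IsRealPoint {ι : Type*} (p : ℙ ℂ (ι → ℂ)) : Prop :=
  ∃ (v : ι → ℝ) (hv : (fun i => (v i : ℂ)) ≠ 0), p = Projectivization.mk ℂ (fun i => (v i : ℂ)) hv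

/-- The product `P` of seven planes, in the coordinates `x, y, z, w = X 0, X 1, X 2, X 3`. -/
noncomputable def planesP : MvPolynomial (Fin 4) ℂ :=
  let x : MvPolynomial (Fin 4) ℂ := X 0
  let y : MvPolynomial (Fin 4) ℂ := X 1
  let z : MvPolynomial (Fin 4) ℂ := X 2
  x * (x ^ 6 - 3 * 7 * x ^ 4 * y ^ 2 + 5 * 7 * x ^ 2 * y ^ 4 - 7 * y ^ 6)
    + 7 * z * ((x ^ 2 + y ^ 2) ^ 3 - 2 ^ 3 * z ^ 2 * (x ^ 2 + y ^ 2) ^ 2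
        + 2 ^ 4 * z ^ 4 * (x ^ 2 + y ^ 2))
    - 2 ^ 6 * z ^ 7

/-- The polynomial `U_α`: a linear form times the square of a cubic form. -/
noncomputable def surfaceU (α : ℂ) : MvPolynomial (Fin 4) ℂ :=
  let x : MvPolynomial (Fin 4) ℂ := X 0
  let y : MvPolynomial (Fin 4) ℂ := X 1
  let z : MvPolynomial (Fin 4) ℂ := X 2
  let w : MvPolynomial (Fin 4) ℂ := X 3
  let a₁ : ℂ := -(12 / 7) * α ^ 2 - 384 / 49 * α - 8 / 7
  let a₂ : ℂ := -(32 / 7) * α ^ 2 + 24 / 49 * α - 4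
  let a₃ : ℂ := -4 * α ^ 2 + 24 / 49 * α - 4
  let a₄ : ℂ := -(8 / 7) * α ^ 2 + 8 / 49 * α - 8 / 7
  let a₅ : ℂ := 49 * α ^ 2 - 7 * α + 50
  (z + C a₅ * w) *
    ((z + w) * (x ^ 2 + y ^ 2) + C a₁ * z ^ 3 + C a₂ * z ^ 2 * w + C a₃ * z * w ^ 2
      + C a₄ * w ^ 3) ^ 2

/-- The equation `P - U_α` of the septic surface `S_α`. -/
noncomputable def septic (α : ℂ) : MvPolynomial (Fin 4) ℂ :=
  planesP - surfaceU α

/-- Symmetry under the dihedral group `D₇` with rotation axis `x = y = 0`: `F` is invariant under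
its generators, the reflection `y ↦ -y` and the rotation of the `(x, y)`-plane by `2π/7`. -/
def IsD7Symmetric (F : MvPolynomial (Fin 4) ℂ) : Prop :=
  aeval ![X 0, -X 1, X 2, X 3] F = F ∧
    aeval ![C (Real.cos (2 * Real.pi / 7) : ℂ) * X 0 - C (Real.sin (2 * Real.pi / 7) : ℂ) * X 1,
      C (Real.sin (2 * Real.pi / 7) : ℂ) * X 0 + C (Real.cos (2 * Real.pi / 7) : ℂ) * X 1,
      X 2, X 3] F = F

/-! Put `q = x² + y²`, `u = x + iy`, `v = x - iy`. The product of the seven planes is a homogenised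
`cos 7θ - T₇`, with `T₇` the Chebyshev polynomial, so the equation reads `(u⁷ + v⁷)/2 - A(q, z, w)`
with `A` = `axial`. The two derivatives in `x` and `y` amount to `7u⁶ = 2v A_q` and `7v⁶ = 2u A_q`.
A singular point thus lies on the axis `u = v = 0`, or has `u⁷ = v⁷ ≠ 0` and is carried by one of
the seven rotations into the plane `y = 0`. There the conditions are `A_z = A_w = 0` and `7x⁵ =
2A_q`; Euler's relation supplies the equation itself.

Write `U = L D²`, with `D` = `cubicForm`. Then `A_w` is `D` times `polarForm`. In the plane `y = 0`
the planes restrict to `(x - z) B²`, with `B` = `sectionCubic`, a product of three lines whose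
slopes `z/x` are the numbers `cos(2kπ/7)`. If `D = 0`, then `B = 0`, and each of the three lines
contributes three points: nine nodes. If `polarForm` vanishes, it determines `q`, being linear in
it; substitution into `A_z` leaves a polynomial of degree nine in `z`. For the special `α` it splits
into `z + 1` (the node on the axis), `lineQuadratic` (two nodes), `minorCubic` (three nodes) and
`extraCubic`, whose roots violate `7x⁵ = 2A_q` (`elimination`, `isPlaneSingular_cases`). Hence there
are 9 + 2 + 3 = 14 points off the axis in the plane, and 7 · 14 + 1 = 99 in all.

Up to nonzero factors the Hessian determinant is constant on orbits and equal to `planeHessian`. At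
the nine base nodes it is nonzero because `B = 0` and `D = 0` meet transversally and neither `x - z`
nor `L` vanishes; at the other nodes it is computed in `ℚ(α)[z]/(f)`, where `f` is the polynomial of
the `z`-coordinates. Nonvanishing in such a ring is certified by an explicit inverse, which turns an
assumed zero into `1 = 0` (`hone`). For real `α` all nodes in the plane are real because the
relevant discriminants are positive, and rotations by seventh roots of unity preserve reality. -/

namespace LabsSeptic

/-! ### The equation as a function of `q`, `z`, `w`, and its derivatives -/

/-- The coefficient of `z ^ 3` in the cubic form. -/
noncomputable def coeff₁ (α : ℂ) : ℂ := -(12 / 7) * α ^ 2 - 384 / 49 * α - 8 / 7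
/-- The coefficient of `z ^ 2 * w` in the cubic form. -/
noncomputable def coeff₂ (α : ℂ) : ℂ := -(32 / 7) * α ^ 2 + 24 / 49 * α - 4
/-- The coefficient of `z * w ^ 2` in the cubic form. -/
noncomputable def coeff₃ (α : ℂ) : ℂ := -4 * α ^ 2 + 24 / 49 * α - 4
/-- The coefficient of `w ^ 3` in the cubic form. -/
noncomputable def coeff₄ (α : ℂ) : ℂ := -(8 / 7) * α ^ 2 + 8 / 49 * α - 8 / 7
/-- The coefficient of `w` in the linear form. -/
noncomputable def coeff₅ (α : ℂ) : ℂ := 49 * α ^ 2 - 7 * α + 50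

/-- The linear form in `U_α`. -/
noncomputable def linForm (α z w : ℂ) : ℂ := z + coeff₅ α * w

/-- The cubic form in `U_α`, in terms of `q = x ^ 2 + y ^ 2`. -/
noncomputable def cubicForm (α q z w : ℂ) : ℂ :=
  (z + w) * q + coeff₁ α * z ^ 3 + coeff₂ α * z ^ 2 * w + coeff₃ α * z * w ^ 2 + coeff₄ α * w ^ 3

/-- The `z`-derivative of `cubicForm`. -/
noncomputable def cubicFormZ (α q z w : ℂ) : ℂ :=
  q + 3 * coeff₁ α * z ^ 2 + 2 * coeff₂ α * z * w + coeff₃ α * w ^ 2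

/-- The `w`-derivative of `cubicForm`. -/
noncomputable def cubicFormW (α q z w : ℂ) : ℂ :=
  q + coeff₂ α * z ^ 2 + 2 * coeff₃ α * z * w + 3 * coeff₄ α * w ^ 2

/-- The septic is `((x + i y) ^ 7 + (x - i y) ^ 7) / 2 - axial α (x ^ 2 + y ^ 2) z w`. -/
noncomputable def axial (α q z w : ℂ) : ℂ :=
  64 * z ^ 7 - 112 * z ^ 5 * q + 56 * z ^ 3 * q ^ 2 - 7 * z * q ^ 3
    + linForm α z w * cubicForm α q z w ^ 2

/-- The `q`-derivative of `axial`. -/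
noncomputable def axialQ (α q z w : ℂ) : ℂ :=
  -112 * z ^ 5 + 112 * z ^ 3 * q - 21 * z * q ^ 2
    + 2 * linForm α z w * (z + w) * cubicForm α q z w

/-- The `z`-derivative of `axial`. -/
noncomputable def axialZ (α q z w : ℂ) : ℂ :=
  448 * z ^ 6 - 560 * z ^ 4 * q + 168 * z ^ 2 * q ^ 2 - 7 * q ^ 3
    + cubicForm α q z w ^ 2 + 2 * linForm α z w * cubicForm α q z w * cubicFormZ α q z w

/-- The cofactor of `cubicForm` in the `w`-derivative of `axial`. -/
noncomputable def polarForm (α q z w : ℂ) : ℂ :=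
  coeff₅ α * cubicForm α q z w + 2 * linForm α z w * cubicFormW α q z w

/-- The `w`-derivative of `axial`. -/
noncomputable def axialW (α q z w : ℂ) : ℂ := cubicForm α q z w * polarForm α q z w

/-- The second `q`-derivative of `axial`, at `w = 1`. -/
noncomputable def axialQQ (α q z : ℂ) : ℂ := 112 * z ^ 3 - 42 * z * q + 2 * linForm α z 1 * (z + 1)
  ^ 2

/-- The mixed second derivative of `axial`, at `w = 1`. -/
noncomputable def axialQZ (α q z : ℂ) : ℂ :=
  -560 * z ^ 4 + 336 * z ^ 2 * q - 21 * q ^ 2 + 2 * (z + 1) * cubicForm α q z 1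
    + 2 * linForm α z 1 * cubicForm α q z 1 + 2 * linForm α z 1 * (z + 1) * cubicFormZ α q z 1

/-- The second `z`-derivative of `axial`, at `w = 1`. -/
noncomputable def axialZZ (α q z : ℂ) : ℂ :=
  2688 * z ^ 5 - 2240 * z ^ 3 * q + 336 * z * q ^ 2
    + 4 * cubicForm α q z 1 * cubicFormZ α q z 1 + 2 * linForm α z 1 * cubicFormZ α q z 1 ^ 2
    + 2 * linForm α z 1 * cubicForm α q z 1 * (6 * coeff₁ α * z + 2 * coeff₂ α)

/-- The `z`-coordinates of the three isolated nodes of the plane section. -/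
noncomputable def minorCubic (α z : ℂ) : ℂ :=
  (1 - 7 * α - 50 * α ^ 2) * z ^ 3 + (1 - 7 * α - 3 * α ^ 2) * z ^ 2 - (1 + 3 * α ^ 2) * z
    - (1 + α ^ 2)

/-- The `x`-coordinate of an isolated node of the plane section in terms of its `z`-coordinate. -/
noncomputable def minorQuadric (α z : ℂ) : ℂ :=
  (4 + 100 / 7 * α + 2 * α ^ 2) * z ^ 2 + (2 + 4 / 7 * α + 2 * α ^ 2) * z + 2 / 7 * α

/-- The `z`-coordinates of the two nodes that lie on the line of the plane section, but not on the
seven planes. -/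
noncomputable def lineQuadratic (α z : ℂ) : ℂ :=
  (3 + 28 * α + 5 * α ^ 2) * z ^ 2 + (8 + 10 * α ^ 2) * z + 5 * (1 + α ^ 2)

/-- The `z`-coordinates of the extraneous common zeros of `axialZ` and `polarForm`. -/
noncomputable def extraCubic (α z : ℂ) : ℂ :=
  (42 - 42 * α + 45 * α ^ 2) * z ^ 3 - (71 - 7 * α + 61 * α ^ 2) * z ^ 2
    - (562 - 77 * α + 551 * α ^ 2) * z - (204 - 28 * α + 200 * α ^ 2)

/-! ### Elimination of `q` -/

theorem polarForm_eq {α : ℂ} (hα : 7 * α ^ 3 + 7 * α + 1 = 0) (q z : ℂ) :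
    polarForm α q z 1 = ((49*α^2 - 7*α + 52)*z + (147*α^2 - 21*α + 150)) * q -
      ((12*α^2 - 8/7*α + 12)*z^3 + (628*α^2 - 612/7*α + 640)*z^2 + (1024*α^2 - 1004/7*α + 1044)*z +
        (408*α^2 - 400/7*α + 416)) := by
  simp only [polarForm, cubicForm, cubicFormW, linForm, coeff₁, coeff₂, coeff₃, coeff₄, coeff₅]
  linear_combination ((-12*α - 372/7)*z^3 + (-96*α + 24)*z^2 + (-140*α + 260/7)*z + (-56*α + 16))*hα

/-- If the coefficient `L` of `q` vanished, so would the constant term `c` of the linear equation `L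
q = c`; but `L` and `c` are coprime as polynomials in `z`, and the certificate is a Bézout identity
for them. -/
theorem polar_leading_ne_zero {α : ℂ} (hα : 7 * α ^ 3 + 7 * α + 1 = 0) {q z : ℂ} (h : polarForm α q
    z 1 = 0) :
    ((49*α^2 - 7*α + 52)*z + (147*α^2 - 21*α + 150)) ≠ 0 := by
  intro h0
  rw [polarForm_eq hα] at h
  have hone : (1 : ℂ) = 0 := by
    linear_combination (((-207/14*α^2 - 621/98*α - 205/343)*z^2 + (-17*α^2 - 167/98*α + 31/343)*z +
      (-12/7*α^2 + 227/49*α + 236/343)) + ((-2129/56*α^2 + 151/4*α + 169/28)) * q) * h0 -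
      ((-2129/56*α^2 + 151/4*α + 169/28)) * h + ((8265/49*α - 14183/343)*z^3 + (188172/49*α -
      1295822/343)*z^2 + (290593/49*α - 2178263/343)*z + (110343/49*α - 896281/343))*hα
  exact one_ne_zero hone

/-- This is a resultant in disguise: the root `q = c / L` of the linear equation is inserted into
`axialZ`. The factorisation of the result is where the choice of `α` enters. -/
theorem elimination {α : ℂ} (hα : 7 * α ^ 3 + 7 * α + 1 = 0) {q z : ℂ}
    (hW : polarForm α q z 1 = 0) (hZ : axialZ α q z 1 = 0) :
    (z + 1) * lineQuadratic α z * minorCubic α z * extraCubic α z = 0 := by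
  rw [polarForm_eq hα] at hW
  obtain ⟨L, hL⟩ : ∃ L : ℂ, L = (49*α^2 - 7*α + 52)*z + (147*α^2 - 21*α + 150) := ⟨_, rfl⟩
  obtain ⟨c, hc⟩ : ∃ c : ℂ, c = (12*α^2 - 8/7*α + 12)*z^3 + (628*α^2 - 612/7*α + 640)*z^2 +
    (1024*α^2 - 1004/7*α + 1044)*z + (408*α^2 - 400/7*α + 416) := ⟨_, rfl⟩
  rw [← hL, ← hc] at hW
  obtain ⟨m, hm⟩ : ∃ m : ℂ, m = (40/7*α^2 - 816/49*α + 40/7)*z^4 + (2928/7*α^2 - 2872/49*α +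
    424)*z^3 + (5800/7*α^2 - 5680/49*α + 5912/7)*z^2 + (5328/7*α^2 - 5224/49*α + 776)*z +
    (1632/7*α^2 - 1600/49*α + 1664/7) := ⟨_, rfl⟩
  obtain ⟨n, hn⟩ : ∃ n : ℂ, n = (-48/7*α^2 - 2336/49*α - 48/7)*z^3 + (176*α^2 - 1324/49*α +
    172)*z^2 + (-2880/7*α^2 + 2792/49*α - 2936/7)*z + (-1416/7*α^2 + 1388/49*α - 1444/7) := ⟨_, rfl⟩
  have hD : L * cubicForm α q z 1 = m := by
    rw [hm]
    simp only [cubicForm, coeff₁, coeff₂, coeff₃, coeff₄]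
    linear_combination (z + 1) * (hW + hc) + (-12/7*α^2*z^3 - 32/7*α^2*z^2 - 4*α^2*z - 8/7*α^2 -
      384/49*α*z^3 + 24/49*α*z^2 + 24/49*α*z + 8/49*α - 8/7*z^3 - 4*z^2 - 4*z - 8/7) * hL + ((-12*α
      - 372/7)*z^4 + (-68*α - 1060/7)*z^3 + (-124*α + 220/7)*z^2 + (-92*α + 172/7)*z + (-24*α +
      48/7))*hα
  have hDz : L * cubicFormZ α q z 1 = n := by
    rw [hn]
    simp only [cubicFormZ, coeff₁, coeff₂, coeff₃]
    linear_combination (hW + hc) + (-36/7*α^2*z^2 - 64/7*α^2*z - 4*α^2 - 1152/49*α*z^2 + 48/49*α*z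
      + 24/49*α - 24/7*z^2 - 8*z - 4) * hL + ((-36*α - 1116/7)*z^3 + (-172*α - 3236/7)*z^2 +
      (-220*α + 388/7)*z + (-84*α + 156/7))*hα
  -- Multiplying `axialZ` by `L³` clears all denominators, since `L q = c`, `L D = m` and `L D_z =
  -- n` are polynomials in `z` alone.
  have hR : 448 * z ^ 6 * L ^ 3 - 560 * z ^ 4 * c * L ^ 2 + 168 * z ^ 2 * c ^ 2 * L - 7 * c ^ 3
      + L * (m ^ 2 + 2 * linForm α z 1 * m * n) = 0 := by
    have hq : L * q = c := by linear_combination hW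
    rw [← hD, ← hDz, ← hq]
    simp only [axialZ] at hZ
    linear_combination L ^ 3 * hZ
  rw [hL, hc, hm, hn] at hR
  simp only [linForm, coeff₅] at hR
  simp only [lineQuadratic, minorCubic, extraCubic]
  -- The first multiplier is the constant of `ℚ(α)` that rescales the degree-nine polynomial to the
  -- product of the four factors; the second records the reduction of powers of `α`.
  linear_combination (-1029/64*α^2 + 1127/32*α + 21/4) * hR + ((86691192*α^5 - 228616262*α^4 +
    1776032068/7*α^3 - 476075352*α^2 + 1201120156/7*α - 241841202)*z^9 + (-432180*α^7 - 675024*α^6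
    - 771755978*α^5 + 2019433199*α^4 - 15153254937/7*α^3 + 28865059900/7*α^2 - 69435894433/49*α +
    14446412577/7)*z^8 + (-21839496*α^7 - 200696503*α^6 - 2668880354*α^5 + 8015334691*α^4 -
    56281990815/7*α^3 + 120136456988/7*α^2 - 269869869197/49*α + 8749852010)*z^7 + (661754016*α^7 -
    2973436473*α^6 + 15019127641*α^5 - 32710214894*α^4 + 34399665543*α^3 - 381385121274/7*α^2 +
    19935921894*α - 170100077261/7)*z^6 + (1810128306*α^7 - 6537110776*α^6 + 58231395082*α^5 -
    141095603103*α^4 + 145241675921*α^3 - 1798060169875/7*α^2 + 621042127291/7*α -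
    838891764692/7)*z^5 + (-4313372490*α^7 + 10546052244*α^6 + 38731531041*α^5 - 107071508558*α^4 +
    129367769840*α^3 - 1678474459259/7*α^2 + 603157096915/7*α - 835411351685/7)*z^4 +
    (-14549987970*α^7 + 39638186175*α^6 - 50885297589*α^5 + 96863178664*α^4 - 51914449430*α^3 +
    515015139971/7*α^2 - 108475428067/7*α + 117657577678/7)*z^3 + (-17306345574*α^7 +
    47664499365*α^6 - 87299392740*α^5 + 183157469537*α^4 - 937554554448/7*α^3 + 1528603000145/7*α^2
    - 445967518646/7*α + 82072700683)*z^2 + (-8788726044*α^7 + 24219354852*α^6 - 44283826587*α^5 +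
    92842479310*α^4 - 475294221278/7*α^3 + 773645228140/7*α^2 - 1582013819375/49*α +
    290407124222/7)*z + (-1560515544*α^7 + 4301215884*α^6 - 7492171932*α^5 + 15513399552*α^4 -
    77343026804/7*α^3 + 124104590224/7*α^2 - 249840763632/49*α + 45239947236/7))*hα

/-- Since `L q = c` with `L ≠ 0`, it suffices that `c` be `L` times the claimed value modulo
`minorCubic`. The next three lemmas follow the same pattern for the other factors. -/
theorem eq_of_minorCubic {α : ℂ} (hα : 7 * α ^ 3 + 7 * α + 1 = 0) {q z : ℂ}
    (hW : polarForm α q z 1 = 0) (hz : minorCubic α z = 0) :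
    q = 4 * z * (1 + 2 * z + α ^ 2 * (1 + z)) := by
  have hL := polar_leading_ne_zero hα hW
  rw [polarForm_eq hα] at hW
  refine mul_left_cancel₀ hL ?_
  simp only [minorCubic] at hz
  linear_combination hW - (((400*α^2 - 56*α + 408))*hz + ((20196/7*α - 4)*z^3 + (1984/7*α +
    360)*z^2 + (1788/7*α - 36)*z + (400/7*α - 8))*hα)

theorem eq_of_lineQuadratic {α : ℂ} (hα : 7 * α ^ 3 + 7 * α + 1 = 0) {q z : ℂ}
    (hW : polarForm α q z 1 = 0) (hz : lineQuadratic α z = 0) :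
    q = ((z + 1) * (1 + α ^ 2)) ^ 2 := by
  have hL := polar_leading_ne_zero hα hW
  rw [polarForm_eq hα] at hW
  refine mul_left_cancel₀ hL ?_
  simp only [lineQuadratic] at hz
  linear_combination hW - (((-50*α^2 + 7*α - 51)*z + (-50*α^2 + 7*α - 51))*hz + ((7*α^3 - α^2 +
    351/7*α + 193)*z^3 + (35*α^3 - 5*α^2 + 1249/7*α + 175)*z^2 + (49*α^3 - 7*α^2 + 1445/7*α - 29)*z
    + (21*α^3 - 3*α^2 + 547/7*α - 11))*hα)

theorem eq_of_extraCubic {α : ℂ} (hα : 7 * α ^ 3 + 7 * α + 1 = 0) {q z : ℂ}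
    (hW : polarForm α q z 1 = 0) (hz : extraCubic α z = 0) :
    q = (-12*α^2 + 8/7*α + 8)*z^2 + (-20*α^2 + 16/7*α - 20)*z + (-8*α^2 + 8/7*α - 8) := by
  have hL := polar_leading_ne_zero hα hW
  rw [polarForm_eq hα] at hW
  refine mul_left_cancel₀ hL ?_
  simp only [extraCubic] at hz
  linear_combination hW - (((8*α^2 + 8))*hz + ((-948/7*α + 68)*z^3 + (-2256/7*α + 88)*z^2 +
    (1076/7*α + 36)*z + (424/7*α + 16))*hα)

theorem eq_zero_of_eq_neg_one {α : ℂ} (hα : 7 * α ^ 3 + 7 * α + 1 = 0) {q : ℂ} (hW : polarForm α q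
    (-1) 1 = 0) : q = 0 := by
  have hL := polar_leading_ne_zero hα hW
  rw [polarForm_eq hα] at hW
  refine mul_left_cancel₀ hL ?_
  linear_combination hW

/-- The hypothesis `hQ` is the square of `7 x⁵ = 2 A_q`, written without `x`. At a root of
`extraCubic` both sides reduce to quadratics in `z` over `ℚ(α)`, and their difference is a unit
modulo `extraCubic`. -/
theorem extraCubic_ne_zero {α : ℂ} (hα : 7 * α ^ 3 + 7 * α + 1 = 0) {q z : ℂ} (hW : polarForm α q z
    1 = 0)
    (hQ : 49 * q ^ 5 = 4 * axialQ α q z 1 ^ 2) : extraCubic α z ≠ 0 := by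
  intro hz
  have hq := eq_of_extraCubic hα hW hz
  simp only [extraCubic] at hz
  obtain ⟨r, hr⟩ : ∃ r : ℂ, r = (-12*α^2 + 8/7*α + 8)*z^2 + (-20*α^2 + 16/7*α - 20)*z + (-8*α^2 +
    8/7*α - 8) := ⟨_, rfl⟩
  rw [← hr] at hq
  rw [hq] at hQ
  have hD : cubicForm α r z 1 = (-12455032/495747*α^2 + 546776/70821*α - 2180912/495747)*z^2 +
    (131784752/2478735*α^2 - 2787304/354105*α + 135679624/2478735)*z + (53894432/2478735*α^2 -
    1053184/354105*α + 55383424/2478735) := by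
    rw [hr]
    simp only [cubicForm, coeff₁, coeff₂, coeff₃, coeff₄]
    linear_combination ((327032/2478735*α^2 + 199856/354105*α + 572104/2478735))*hz +
      ((-327032/385581*α - 2343776/826245)*z^3 + (327032/284445*α + 3954728/826245)*z^2 +
      (180194632/17351145*α + 35507768/826245)*z + (13081280/3470229*α + 5523296/354105))*hα
  have hG : axialQ α r z 1 = (44850524141638991216/1776054009988305*α^2 -
    6228060332181775984/1776054009988305*α + 45662915030231160592/1776054009988305)*z^2 +
    (-627330311700880278736/8880270049941525*α^2 + 87906528254737900544/8880270049941525*α -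
    639646899740989394912/8880270049941525)*z + (-275787690992816939776/8880270049941525*α^2 +
    38641999221897226304/8880270049941525*α - 281205085845862731392/8880270049941525) := by
    rw [axialQ, hD, hr]
    simp only [linForm, coeff₅]
    linear_combination ((-7369376/118035*α^2 - 19444016/118035*α - 26098864/826245)*z^2 +
      (1101364353376/25078070205*α^2 + 142489651456/25078070205*α + 12843682628144/175546491435)*z
      + (-1352853066526938256/8880270049941525*α^2 + 235142746596854624/8880270049941525*α -
      9939752943865921664/62161890349590675))*hz + ((-80368/2623*α + 30164528/39345)*z^5 +
      (-6315194401376/2786452245*α - 1411704584048/1671871347)*z^4 +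
      (-1120908147294244976/197339334443145*α - 264992663889055583024/20720630116530225)*z^3 +
      (-32299103042978848/145578197540025*α - 81244780127451653728/20720630116530225)*z^2 +
      (-87738105595085016368/8880270049941525*α + 72521043794476306112/20720630116530225)*z +
      (-7189961611840664896/1776054009988305*α + 79616939898919292288/62161890349590675))*hα
  have h2 : r ^ 2 = (3139722946816/5015614041*α^2 - 478386122624/5015614041*α +
    3141714980432/5015614041)*z^2 + (-10113730335376/5015614041*α^2 + 1417564880864/5015614041*α -
    10314489822752/5015614041)*z + (-4368341059072/5015614041*α^2 + 611566241408/5015614041*α -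
    4454591726144/5015614041) := by
    rw [hr]
    linear_combination ((325136/70821*α^2 + 5141792/495747*α + 8844832/3470229)*z +
      (-13670250832/5015614041*α^2 - 1971728752/5015614041*α - 1150622597552/245765088009))*hz +
      ((-492544/55083*α - 7113728/165249)*z^4 + (491918875904/3901033143*α +
      4718570025472/81921696003)*z^3 + (242998948016/575562267*α + 61082193175184/81921696003)*z^2
      + (-1322020384112/35109298287*α + 21730166152064/81921696003)*z +
      (-2413050867776/35109298287*α - 723049686976/245765088009))*hα
  have h4 : (r ^ 2) ^ 2 = (3112543545921028917739738953534520064/630873569279107639341247354605*α^2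
    - 3052651910904730148512082152180648192/4416114984953753475388731482235*α +
    3173643540944347255603377442453650688/630873569279107639341247354605)*z^2 +
    (-11860883266917561453596526095917823744/630873569279107639341247354605*α^2 +
    11632536586178803198745506256457663232/4416114984953753475388731482235*α -
    12093711661724176559076233795080661248/630873569279107639341247354605)*z +
    (-5050124945731207534661851128712444928/630873569279107639341247354605*α^2 +
    4952899571315127154812684350842614784/4416114984953753475388731482235*α -
    5149258532531404834492728815365758976/630873569279107639341247354605) := by
    rw [h2]
    linear_combination ((73390502671218014285318159104/8908001430071696803790505*α^2 -
      10268064682920922291105999616/8908001430071696803790505*α +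
      74779953674282086923463962368/8908001430071696803790505)*z +
      (-26230821243860088257043905193586688/630873569279107639341247354605*α^2 +
      3674410628733521502621991301201152/630873569279107639341247354605*α -
      26745724987043466043297385598992896/630873569279107639341247354605))*hz +
      ((597285586706230543547175680/197955587334926595639789*α +
      118130127771649635409487890688/2969333810023898934596835)*z^4 +
      (-1511647930512144994012010186308352/70097063253234182149027483845*α -
      8398886753350968207492324727155968/42058237951940509289416490307)*z^3 +
      (51492703453747079094210461013116416/72395327622192679924405434135*α -
      43385931323663702823086055713067776/210291189759702546447082451535)*z^2 +
      (-11197755255002245325521514888097568768/4416114984953753475388731482235*α +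
      149170871007574391020286459612951296/210291189759702546447082451535)*z +
      (-953522878280212413322489773922942976/883222996990750695077746296447*α +
      190764498666155175044216758278019072/630873569279107639341247354605))*hα
  have h5 : (r ^ 2) ^ 2 * r =
    (1433665848163963327416971960480634809633386775552/3164218332172078523830324222210944008805*α^2
    - 1406064809376973282189203496587856012090690502656/22149528325204549666812269555476608061635*α
    +
    1461808598169317885959848476197148962721743965184/3164218332172078523830324222210944008805)*z^2
    +
    (-28081648485737294642147190104807419809071519945728/15821091660860392619151621111054720044025*α^2 + 27541020182394482555455966846231863284206041181184/110747641626022748334061347777383040308175*α - 28632889302672462263924156171103892776060128792576/15821091660860392619151621111054720044025)*z + (-11926581348002547923358797362259127996381702995968/15821091660860392619151621111054720044025*α^2 + 11696970627302495460453984463786698197587961851904/110747641626022748334061347777383040308175*α - 12160699315354291958228665627643474927616355782656/15821091660860392619151621111054720044025) := by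
    rw [h4, hr]
    linear_combination
      ((34371829192547145683547584649881125092352/44679097049915682125786478900480705*α^2 -
      33709741247354008614056074353347981997056/312753679349409774880505352303364935*α +
      1717288875460254914359220273723834143548416/2189275755445868424163537466123554545)*z +
      (-61269714865657056343630235493744244155807305728/15821091660860392619151621111054720044025*α^2 + 60090221013849505865489188203331353806482141184/110747641626022748334061347777383040308175*α - 3061149654911152996517746809837136924141174836224/775233491382159238338429434441681282157225))*hz + ((-465770407916966647062065993153763286065152/34750408816601086097833928033707215*α + 760953621059589688411179604456518293233664/104251226449803258293501784101121645)*z^4 + (122396169956059668735379772636799309397700174848/2461058702800505518534696617275178673515*α - 8380712120083212100594208883227273792432128907264/258411163794053079446143144813893760719075)*z^3 + (22981676774305206905408614087992231179156289536/259362158374760534740190510017290492525*α - 6110048990592707824681092997199551656853817893888/258411163794053079446143144813893760719075)*z^2 + (-3773261901568818429709524934903047097764282497024/15821091660860392619151621111054720044025*α + 17379089869221586621489781371515774546123624230912/258411163794053079446143144813893760719075)*z + (-2248152773933371793563329622083995069973763956736/22149528325204549666812269555476608061635*α + 22020055907632090611804809594911781578870635511808/775233491382159238338429434441681282157225))*h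α
  have hs :
    (-349202756121469664220019205478226013701022727716864/43947476835723312830976725308485333455625*α^2 + 48925697902612429140563458078806826545201553094656/43947476835723312830976725308485333455625*α - 356057580112985781505635868232239566758243014924288/43947476835723312830976725308485333455625)*z^2 + (131453811739090724788190754830509681217280922006528/8789495367144662566195345061697066691125*α^2 - 18417580155488759452727341651159535670422582976512/8789495367144662566195345061697066691125*α + 134034240968864120149419600802666561239164186802176/8789495367144662566195345061697066691125)*z + (306259869657740652438338055681102642386458754883584/43947476835723312830976725308485333455625*α^2 - 42909107163064672801323681896053836944833208897536/43947476835723312830976725308485333455625*α + 312271729732202353013175338139393923746480391446528/43947476835723312830976725308485333455625) = 0 := by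
    rw [hG] at hQ
    linear_combination hQ - 49 * h5 +
      ((61667243799287484119454116744910641397692416/1116977426247892053144661972512017625*α^2 -
      8639919042656258285527132002398414906430464/1116977426247892053144661972512017625*α +
      62878030429743665071104241517965615084009472/1116977426247892053144661972512017625)*z +
      (-89602658989588021892880510175041511748067034534912/395527291521509815478790527776368001100625*α^2 + 12553963481298832821895685662434529568131348917248/395527291521509815478790527776368001100625*α - 91361563594219691572656325233173368784299368034304/395527291521509815478790527776368001100625))*hz + ((47111950839876403484515320568166688461824/4964344116657298013976275433386745*α + 104167542112285138094520456077731559053540352/372325808749297351048220657504005875)*z^4 + (-890902497405909271926918552603142732583171560448/8789495367144662566195345061697066691125*α - 147279949346152738454447914669247909529506808633344/131842430507169938492930175925456000366875)*z^3 + (28056496246617873375312670173426854529255004952576/6484053959369013368504762750432262313125*α - 6656395733480588824517188615790387062932171738112/5273697220286797539717207037018240014675)*z^2 + (-5437388432123377996867910465155401395529353134134272/395527291521509815478790527776368001100625*α + 507041623963348672706292812154479142806096588945408/131842430507169938492930175925456000366875)*z + (-2342086349116276936537439159298268954769121091739648/395527291521509815478790527776368001100625*α + 6560080641699908045181211723564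94713128310670815232/395527291521509815478790527776368001100625))*hα
  have hone : (1 : ℂ) = 0 := by
    linear_combination ((303470005004932260657/121561946734592*α^2 -
      1603459324346129085125/392738597142528*α - 8710772960569204531/14026378469376)*z^2 +
      (1492514676511101728395/2188115041222656*α^2 + 148952163577827668795/1701867254284288*α -
      47425131653674345/42079135408128)*z + (8520736620426261199/364685840203776*α^2 -
      1376392508314521757015/15316805288558592*α - 28552431053574773015/2188115041222656)) * hs +
      ((322310768976796379602371602199271224449735406667692743773/106472035200572248266261950501032008233728031730000*α^2 + 373025235873511076582002554178810411466316431138366467441/46581515400250358616489603344201503602256013881875*α + 99929461329837770920506965660617966036524104049348316189/93163030800500717232979206688403007204512027763750)*z + (69600013637737959952837171548017571596434448144668845017/106472035200572248266261950501032008233728031730000*α^2 - 310337665383589746063313049012477352264043172083891713977/1490608492808011475727667307014448115272192444220000*α - 48342286365823300844137250584928427429243662725027150877/745304246404005737863833653507224057636096222110000))*hz + ((704005642937969063134057176688973407274165641032467611353262593821/248434748801335245954611217835741352545365407370000*α - 401785495030622860922555241976303733685372393460427698976319253361/79854026400429186199696462875774006175296023797500)*z^4 + (-4369071935439098436620548849783339459472200510730863900499477767259/958248316805150234396357554509288074103552285570000*α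 + 31731465134160026748277649237371270090252067461432755297332105944517/3353869108818025820387251440782508259362432999495000)*z^3 + (-52536333689763175635741430494453029653496285243492789741227260010763/13415476435272103281549005763130033037449731997980000*α + 14502875683866529841362518728171737783539522244434908293676351542763/3353869108818025820387251440782508259362432999495000)*z^2 + (-2444892760790312237860414745813808892106703004262487851229853519421/3353869108818025820387251440782508259362432999495000*α + 11867279377601311069127515238923559641760474674336323439155330533/57331095877231210604910281039017235202776632470000)*z + (-3250505210919455729153385653731648128768255023847252784852846826/139744546200751075849468810032604510806768041645625*α + 38871179900020261609464507476998566572952484442247198842192780503/419233638602253227548406430097813532420304124936875))*hα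
  exact one_ne_zero hone

/-! ### Singularity conditions in the plane `y = 0` -/

/-- In the plane `y = 0`, the product of the seven planes is `x - z` times the square of this. -/
noncomputable def sectionCubic (x z : ℂ) : ℂ := 8 * z ^ 3 + 4 * z ^ 2 * x - 4 * z * x ^ 2 - x ^ 3

/-- The conditions for `(x : 0 : z : 1)`, `x ≠ 0`, to be a singular point of the septic. -/
def IsPlaneSingular (α x z : ℂ) : Prop :=
  axialZ α (x ^ 2) z 1 = 0 ∧ axialW α (x ^ 2) z 1 = 0 ∧ 7 * x ^ 5 = 2 * axialQ α (x ^ 2) z 1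

/-- Up to a factor vanishing only at `x = 0`, the Hessian determinant of the septic at a singular
point `(x : 0 : z : 1)`. -/
noncomputable def planeHessian (α x z : ℂ) : ℂ :=
  (35 * x ^ 3 - 4 * axialQQ α (x ^ 2) z) * axialZZ α (x ^ 2) z + 4 * axialQZ α (x ^ 2) z ^ 2

/-- Euler's relation for weighted degree seven; `q` has weight two, whence the factor `2`. -/
theorem axial_euler (α q z w : ℂ) :
    2 * q * axialQ α q z w + z * axialZ α q z w + w * axialW α q z w = 7 * axial α q z w := by
  simp only [axialQ, axialZ, axialW, axial, polarForm, cubicForm, cubicFormZ, cubicFormW, linForm]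
  ring

/-! ### The three nodes over the roots of `minorCubic` -/

theorem isPlaneSingular_of_minorCubic {α : ℂ} (hα : 7 * α ^ 3 + 7 * α + 1 = 0) {z : ℂ} (hz :
    minorCubic α z = 0) :
    IsPlaneSingular α (minorQuadric α z) z := by
  simp only [minorCubic] at hz
  have hX : (minorQuadric α z) ^ 2 = (4*α^2 + 8)*z^2 + (4*α^2 + 4)*z := by
    simp only [minorQuadric]; linear_combination ((8*α^2 - 4/7*α + 192/49)*z + (-4/7*α - 4/49))*hz
      + ((404/7*α + 592/49)*z^4 + (32/7*α + 596/49)*z^3 + (4*α)*z^2 + (8/7*α - 8/49)*z + (-4/49))*hα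
  -- The reduced value of `x²` is kept opaque. Each ingredient is brought to normal form, of degree
  -- at most two in `α` and in `z`, before being combined, so that every single identity stays of
  -- low degree.
  obtain ⟨r, hr⟩ : ∃ r : ℂ, r = (4*α^2 + 8)*z^2 + (4*α^2 + 4)*z := ⟨_, rfl⟩
  rw [← hr] at hX
  have hD : cubicForm α r z 1 = (-10860744/959707*α^2 + 520040/137101*α - 6366792/959707)*z^2 +
    (7896464/959707*α^2 - 51976/137101*α + 7864032/959707)*z + (6290824/959707*α^2 -
    123192/137101*α + 6449624/959707) := by
    rw [hr]
    simp only [cubicForm, coeff₁, coeff₂, coeff₃, coeff₄]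
    linear_combination ((7133216/959707*α^2 - 158800/137101*α + 1055376/137101))*hz +
      ((356660800/6717949*α - 806784/959707)*z^3 + (21399648/6717949*α + 6656816/959707)*z^2 +
      (21399648/6717949*α - 476400/959707)*z + (7133216/6717949*α - 158800/959707))*hα
  have hE : cubicFormZ α r z 1 = (-8/7*α^2 - 1152/49*α + 32/7)*z^2 + (-36/7*α^2 + 48/49*α - 4)*z +
    (-4*α^2 + 24/49*α - 4) := by
    rw [hr]
    simp only [cubicFormZ, coeff₁, coeff₂, coeff₃]
    linear_combination 
  have hF : cubicFormW α r z 1 = (-4/7*α^2 + 24/49*α + 4)*z^2 + (-4*α^2 + 48/49*α - 4)*z +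
    (-24/7*α^2 + 24/49*α - 24/7) := by
    rw [hr]
    simp only [cubicFormW, coeff₂, coeff₃, coeff₄]
    linear_combination 
  have h2 : r ^ 2 = (3576742705488/18796684201*α^2 - 3665867460768/131576789407*α +
    3624464180800/18796684201)*z^2 + (57966825488/18796684201*α^2 - 80874305600/131576789407*α +
    61388878320/18796684201)*z + (-1079796487248/18796684201*α^2 + 1057331916800/131576789407*α -
    1101199427264/18796684201) := by
    rw [hr]
    linear_combination ((8427232/137101*α^2 - 1159088/137101*α + 8626432/137101)*z +
      (-1057331916800/18796684201*α^2 + 149820580112/18796684201*α - 1079796487248/18796684201))*hz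
      + ((60507888/137101*α + 148032/137101)*z^4 + (-6971279448896/18796684201*α +
      1100091822480/18796684201)*z^3 + (594897000112/131576789407*α -
      1061228292704/18796684201)*z^2 + (-2016613815968/131576789407*α + 41507088064/18796684201)*z
      + (-1057331916800/131576789407*α + 21402940016/18796684201))*hα
  refine ⟨?_, ?_, ?_⟩
  · rw [hX, axialZ, hD, hE, hr]
    simp only [linForm, coeff₅]
    linear_combination ((413707392/137101*α^2 - 57065728/137101*α + 422600192/137101)*z^3 +
      (-2670903334542848/921037525849*α^2 + 2625259968694208/6447262680943*α -
      2723533686312832/921037525849)*z^2 + (3040537334899392/921037525849*α^2 -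
      2981946487508928/6447262680943*α + 3100101693569536/921037525849)*z +
      (2521978337815424/921037525849*α^2 - 2473380752646336/6447262680943*α +
      2571482600347648/921037525849))*hz + ((-64*α^3 + 2963827264/137101*α + 7348544/137101)*z^6 +
      (-192*α^3 - 125183546944195072/6447262680943*α + 2717035642929600/921037525849)*z^5 +
      (-10491840/959707*α^3 + 24441670912/6717949*α^2 + 135936469496911296/6447262680943*α -
      172400085135232/921037525849)*z^4 + (594208896/959707*α^3 - 21685666560/6717949*α^2 +
      142810181947288320/6447262680943*α - 129541642762752/921037525849)*z^3 +
      (-60996928/959707*α^3 - 2191907520/959707*α^2 + 2811754060992320/921037525849*α -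
      70258753031872/921037525849)*z^2 + (-895141312/959707*α^3 + 2455334208/6717949*α^2 -
      1190767970970688/6447262680943*α + 228740055046976/921037525849)*z + (-50326592/137101*α^3 +
      992284544/6717949*α^2 - 2407237156831040/6447262680943*α + 137180530021824/921037525849))*hα
  · have hP : polarForm α r z 1 = 0 := by
      rw [polarForm, hD, hF]
      simp only [linForm, coeff₅]
      linear_combination ((6974416/959707*α^2 - 131224/137101*α + 7264440/959707))*hz +
        ((348720800/6717949*α + 413216/959707)*z^3 + (-564996800/6717949*α + 50601104/959707)*z^2 +
        (31644840/6717949*α + 10002392/959707)*z + (-7236760/6717949*α + 703240/959707))*hα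
    rw [hX, axialW, hP, mul_zero]
  · have h5 : (minorQuadric α z) ^ 5 = (2557668759259667968/2577044200641301*α^2 -
    2498522906332096384/18039309404489107*α + 2605304092413126624/2577044200641301)*z^2 +
    (-271177995747490272/2577044200641301*α^2 + 264311636987914784/18039309404489107*α -
    276706526571319936/2577044200641301)*z + (-952490082055172960/2577044200641301*α^2 +
    934262930716177504/18039309404489107*α - 971216730898542496/2577044200641301) := by
      calc (minorQuadric α z) ^ 5 = (((minorQuadric α z) ^ 2) ^ 2) * (minorQuadric α z) := by ring
        _ = _ := by
          rw [hX, h2]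
          simp only [minorQuadric]; linear_combination ((7248928361600/18796684201*α^2 -
            7153485410976/131576789407*α + 362529224639936/921037525849)*z +
            (-940131659674444736/2577044200641301*α^2 + 923765623471089760/18039309404489107*α -
            46961936546953868640/126275165831423749))*hz + ((369599903490976/131576789407*α +
            347865754796864/921037525849)*z^4 + (-43028432378998390848/18039309404489107*α +
            47606377772360224224/126275165831423749)*z^3 + (-119076734026084928/18039309404489107*α
            - 1219617069617195616/2577044200641301)*z^2 + (-2122642008115988704/18039309404489107*α
            + 1504199300023150688/126275165831423749)*z + (-940131659674444736/18039309404489107*α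
            + 627683267074713664/126275165831423749))*hα
    rw [h5, hX, axialQ, hD, hr]
    simp only [linForm, coeff₅]
    linear_combination ((149823072/137101*α^2 - 20851264/137101*α + 152667648/137101)*z^2 +
      (-5991525522752/18796684201*α^2 + 848478771040/18796684201*α - 42932353057472/131576789407)*z
      + (9999160621585082976/2577044200641301*α^2 - 1402531975497868960/2577044200641301*α +
      71360241295074644672/18039309404489107))*hz + ((1083326496/137101*α + 885472/137101)*z^5 +
      (-30384407655520/18796684201*α + 135693323415648/131576789407)*z^4 +
      (73341441510798435552/2577044200641301*α - 1348842105555610560/2577044200641301)*z^3 +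
      (4558492599184570912/2577044200641301*α + 63796283089798052544/18039309404489107)*z^2 +
      (3101309500332942016/2577044200641301*α - 2379227544375033760/18039309404489107)*z +
      (955464989001011072/2577044200641301*α - 475687627592022432/18039309404489107))*hα

/-- The normal form of `planeHessian` in `ℚ(α)[z]/(minorCubic)` is the left side of `hs`; its
inverse there is the multiplier of `hs` in `hone`. -/
theorem planeHessian_ne_zero_of_minorCubic {α : ℂ} (hα : 7 * α ^ 3 + 7 * α + 1 = 0) {z : ℂ} (hz :
    minorCubic α z = 0) :
    planeHessian α (minorQuadric α z) z ≠ 0 := by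
  intro hH
  simp only [minorCubic] at hz
  have hX : (minorQuadric α z) ^ 2 = (4*α^2 + 8)*z^2 + (4*α^2 + 4)*z := by
    simp only [minorQuadric]; linear_combination ((8*α^2 - 4/7*α + 192/49)*z + (-4/7*α - 4/49))*hz
      + ((404/7*α + 592/49)*z^4 + (32/7*α + 596/49)*z^3 + (4*α)*z^2 + (8/7*α - 8/49)*z + (-4/49))*hα
  obtain ⟨r, hr⟩ : ∃ r : ℂ, r = (4*α^2 + 8)*z^2 + (4*α^2 + 4)*z := ⟨_, rfl⟩
  rw [← hr] at hX
  have hD : cubicForm α r z 1 = (-10860744/959707*α^2 + 520040/137101*α - 6366792/959707)*z^2 +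
    (7896464/959707*α^2 - 51976/137101*α + 7864032/959707)*z + (6290824/959707*α^2 -
    123192/137101*α + 6449624/959707) := by
    rw [hr]
    simp only [cubicForm, coeff₁, coeff₂, coeff₃, coeff₄]
    linear_combination ((7133216/959707*α^2 - 158800/137101*α + 1055376/137101))*hz +
      ((356660800/6717949*α - 806784/959707)*z^3 + (21399648/6717949*α + 6656816/959707)*z^2 +
      (21399648/6717949*α - 476400/959707)*z + (7133216/6717949*α - 158800/959707))*hα
  have hE : cubicFormZ α r z 1 = (-8/7*α^2 - 1152/49*α + 32/7)*z^2 + (-36/7*α^2 + 48/49*α - 4)*z +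
    (-4*α^2 + 24/49*α - 4) := by
    rw [hr]
    simp only [cubicFormZ, coeff₁, coeff₂, coeff₃]
    linear_combination 
  have h3 : (minorQuadric α z) ^ 3 = (4882392/137101*α^2 - 7664792/959707*α + 5177208/137101)*z^2 +
    (1081992/137101*α^2 - 1020800/959707*α + 1145984/137101)*z + (-997208/137101*α^2 +
    940000/959707*α - 1014016/137101) := by
    calc (minorQuadric α z) ^ 3 = (minorQuadric α z) ^ 2 * (minorQuadric α z) := by ring
      _ = _ := by
        rw [hX, hr]
        simp only [minorQuadric]; linear_combination ((16*α^2 - 8/7*α + 16)*z + (-940000/137101*α^2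
          + 117656/137101*α - 997208/137101))*hz + ((808/7*α + 16)*z^4 + (-38225536/959707*α +
          3190824/137101)*z^3 + (4857656/959707*α - 889576/137101)*z^2 + (-626384/959707*α +
          50424/137101)*z + (-940000/959707*α + 16808/137101))*hα
  have hQQ : axialQQ α r z = (45349556/137101*α^2 - 10131254/137101*α + 48404300/137101)*z^2 +
    (-4268600/137101*α^2 + 668234/137101*α - 3794924/137101)*z + (-16346470/137101*α^2 +
    2238208/137101*α - 16641254/137101) := by
    rw [axialQQ, hr]
    simp only [linForm, coeff₅]
    linear_combination ((-29103354/137101*α^2 + 3982902/137101*α - 29782368/137101))*hz +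
      ((-207881100/137101*α - 654054/137101)*z^3 + (-12472866/137101*α - 27396396/137101)*z^2 +
      (-12472866/137101*α + 1706958/137101)*z + (-4157622/137101*α + 568986/137101))*hα
  have hQZ : axialQZ α r z = (28019055493632/18796684201*α^2 - 4138301740944/18796684201*α +
    198202695454840/131576789407)*z^2 + (876293436480/18796684201*α^2 - 154842948432/18796684201*α
    + 6388907239384/131576789407)*z + (-8279539434152/18796684201*α^2 + 1157419276744/18796684201*α
    - 59116518631192/131576789407) := by
    rw [axialQZ, hD, hE, hr]
    simp only [linForm, coeff₅]
    linear_combination ((718495968/959707*α^2 - 13948832/137101*α + 105732912/137101)*z +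
      (-94200082766448/131576789407*α^2 + 1919171354520/18796684201*α -
      96185417828280/131576789407))*hz + ((35602336848/6717949*α + 21054368/959707)*z^4 +
      (-4517640794091184/921037525849*α + 51520990768336/131576789407)*z^3 +
      (-258265653276616/921037525849*α - 124063493534896/131576789407)*z^2 +
      (-195890451034576/921037525849*α + 6094242894024/131576789407)*z +
      (-61255314614040/921037525849*α + 493874842560/131576789407))*hα
  have hZZ : axialZZ α r z = (61644599039140638304/2577044200641301*α^2 -
    8590245730536046912/2577044200641301*α + 439210880097782347488/18039309404489107)*z^2 +
    (-9203176429963477920/2577044200641301*α^2 + 1279034568020489280/2577044200641301*α -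
    65737910368217583712/18039309404489107)*z + (-24373724202887922016/2577044200641301*α^2 +
    3415476788318422688/2577044200641301*α - 173974164615570918720/18039309404489107) := by
    rw [axialZZ, hD, hE, hr]
    simp only [linForm, coeff₁, coeff₂, coeff₅]
    linear_combination ((42401888640/6717949*α^2 - 42213516032/47025643*α +
      2106301356800/329179501)*z^2 + (5435446807184384/921037525849*α^2 -
      5423691515704576/6447262680943*α + 272215827968823808/45130838766601)*z +
      (-662145185881189194400/126275165831423749*α^2 + 652392250035861656192/883926160819966243*α -
      33071691511417066179136/6187483125739763701))*hz + ((2156227674752/47025643*α -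
      27929166976/329179501)*z^5 + (128/7*α^3 + 5248/7*α^2 + 347655733103048960/6447262680943*α +
      94773938268689664/45130838766601)*z^4 + (1721887488/959707*α^3 + 9598263168/959707*α^2 -
      30467390031411673207712/883926160819966243*α +
      75415726804894373368288/6187483125739763701)*z^3 + (731292704/959707*α^3 -
      3488484960/959707*α^2 + 1770181483910383346112/883926160819966243*α -
      55701241501947882182880/6187483125739763701)*z^2 + (-1363834816/959707*α^3 -
      3840265920/959707*α^2 - 2498746689259933626880/883926160819966243*α -
      24421285226852950017920/6187483125739763701)*z + (-590251104/959707*α^3 +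
      228328992/959707*α^2 - 1726658287641995001024/883926160819966243*α +
      2570165133914899470912/6187483125739763701))*hα
  have hs : (4187034020192231892272024576/353315336952123008401*α^2 -
    586641709621211976973581312/353315336952123008401*α +
    4269225418639001590197964032/353315336952123008401)*z^2 +
    (-186913591810774073889894656/353315336952123008401*α^2 +
    26187539475190504523417088/353315336952123008401*α -
    190581587980991421808317696/353315336952123008401)*z +
    (-1416739999496341260104672000/353315336952123008401*α^2 +
    198494883709100962096277248/353315336952123008401*α -
    1444550501616757950675427328/353315336952123008401) = 0 := by
    rw [planeHessian, hX, h3, hQQ, hQZ, hZZ] at hH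
    linear_combination hH + ((-18098193154600660517888/2577044200641301*α^2 +
      17749420746409605489408/18039309404489107*α - 18453477672701434277888/2577044200641301)*z +
      (902999087898259907915853056/353315336952123008401*α^2 -
      885615802829620322166898944/2473207358664861058807*α +
      920725935784199514741658112/353315336952123008401))*hz +
      ((-923086822738643304730880/18039309404489107*α +
      36481597598818656888832/126275165831423749)*z^4 +
      (34025914858098786422216477696/2473207358664861058807*α -
      106974484926595658057056698112/17312451510654027411649)*z^3 +
      (-644543275275439564686404864/353315336952123008401*α +
      48465451286359388919657722112/17312451510654027411649)*z^2 +
      (1905498108982485421441774080/2473207358664861058807*α -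
      3539371846389052263064399360/17312451510654027411649)*z +
      (1371794854042702086106954240/2473207358664861058807*α -
      1803387161700438789506540800/17312451510654027411649))*hα
  have hone : (1 : ℂ) = 0 := by
    linear_combination ((-112227291/75712*α^2 - 544288071/529984*α - 425859195/3709888)*z^2 +
      (-262043/1352*α^2 - 747129161/2119936*α - 338136109/7419776)*z + (-851023/21632*α^2 -
      140007731/2119936*α - 62935451/7419776)) * hs +
      ((-504153079637036199494641644/59710291944908788419769*α^2 +
      825885092727104651604945576/417972043614361518938383*α -
      23959052575521790276764149088/2925804305300530632568681)*z +
      (298368349521131125226073429/59710291944908788419769*α^2 -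
      32375168418390945279982337/59710291944908788419769*α +
      1134711474734971418140756683/225061869638502356351437))*hz +
      ((149836796040188014956194028468456/59710291944908788419769*α +
      4058258110961377336088100097422468/2925804305300530632568681)*z^4 +
      (90338047614884668421133860139362/417972043614361518938383*α +
      1429984016088755204849297252232747/2925804305300530632568681)*z^3 +
      (-3661415747426623557686823982555/4593099380377599109213*α -
      1145247546211280238062452125561579/2925804305300530632568681)*z^2 +
      (-47648175928124014500868635625803/417972043614361518938383*α -
      558546065016092155995368421311347/2925804305300530632568681)*z +
      (-9419063542520594714172104234821/417972043614361518938383*α -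
      101451135681638973534865874096008/2925804305300530632568681))*hα
  exact one_ne_zero hone

/-- Separates these nodes from the nine base nodes, so that nothing is counted twice. -/
theorem sectionCubic_ne_zero_of_minorCubic {α : ℂ} (hα : 7 * α ^ 3 + 7 * α + 1 = 0) {z : ℂ} (hz :
    minorCubic α z = 0) :
    sectionCubic (minorQuadric α z) z ≠ 0 := by
  intro hB
  simp only [minorCubic] at hz
  simp only [sectionCubic, minorQuadric] at hB
  have hs : (1723568/137101*α^2 - 3546416/959707*α + 1872840/137101)*z^2 + (-4471640/137101*α^2 +
    4489200/959707*α - 4541176/137101)*z + (-3254816/137101*α^2 + 3194808/959707*α -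
    3318000/137101) = 0 := by
    linear_combination hB + ((768/49*α^2 - 21176/343*α - 24/49)*z^3 + (1528/49*α^2 - 3160/343*α +
      160/7)*z^2 + (360/49*α^2 - 1592/343*α + 360/49)*z + (155448784/6717949*α^2 -
      152801592/47025643*α + 3254816/137101))*hz + ((8/7*α^3 + 1200/49*α^2 + 100360/343*α +
      3160/49)*z^6 + (24/7*α^3 + 2448/49*α^2 + 148992/343*α + 6744/49)*z^5 + (24/7*α^3 +
      1320/49*α^2 + 37280/343*α + 3200/49)*z^4 + (8/7*α^3 + 96/49*α^2 + 188257408/959707*α -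
      4836056/6717949)*z^3 + (24/49*α^2 + 840357880/47025643*α + 135192656/6717949)*z^2 +
      (518993136/47025643*α - 13675280/6717949)*z + (155448784/47025643*α - 63184/137101))*hα
  have hone : (1 : ℂ) = 0 := by
    linear_combination ((32317/52*α^2 - 19731/26*α - 12293/104)*z^2 + (789/13*α^2 - 341/104*α -
      127/104)*z + (1213/104*α^2 - 5207/104*α - 102/13)) * hs + ((-78273519/1782313*α^2 -
      48993977/12476191*α - 54216490/12476191)*z + (28897501/1782313*α^2 + 59922991/12476191*α +
      177456049/12476191))*hz + ((-17838812714/12476191*α + 20199185845/12476191)*z^4 +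
      (35977656811/12476191*α - 48761712211/12476191)*z^3 + (29415132076/12476191*α -
      5012679316/1782313)*z^2 + (464925889/1782313*α - 3487872855/12476191)*z +
      (522408977/12476191*α - 2179119760/12476191))*hα
  exact one_ne_zero hone

theorem coordinate_ne_zero_of_minorCubic {α : ℂ} (hα : 7 * α ^ 3 + 7 * α + 1 = 0) {z : ℂ} (hz :
    minorCubic α z = 0) :
    minorQuadric α z ≠ 0 := by
  intro hs
  simp only [minorCubic] at hz
  simp only [minorQuadric] at hs
  have hone : (1 : ℂ) = 0 := by
    linear_combination ((25*α^2 - 2449/14*α - 24)*z^2 + (49/2*α^2 - 243/14*α - 3/2)*z + (-1/2*α^2 -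
      24/7*α - 2)) * hs + ((48*α^2 + 50/7*α - 97/49)*z + (3*α^2 - 48/49))*hz + ((2350/7*α +
      4801/49)*z^4 + (195/7*α + 2791/49)*z^3 + (15*α + 10)*z^2 + (58/7*α + 51/49)*z + (3/7*α +
      1/49))*hα
  exact one_ne_zero hone

/-- The quadratic is the `z`-derivative of `minorCubic`; with the nonzero leading coefficient this
yields exactly three roots. -/
theorem minorCubic_separable {α : ℂ} (hα : 7 * α ^ 3 + 7 * α + 1 = 0) {z : ℂ} (hz : minorCubic α z
    = 0) :
    (-150*α^2 - 21*α + 3)*z^2 + (-6*α^2 - 14*α + 2)*z + (-3*α^2 - 1) ≠ 0 := by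
  intro hs
  simp only [minorCubic] at hz
  have hone : (1 : ℂ) = 0 := by
    linear_combination ((-14*α^2 - 200/49*α - 2/343)*z^2 + (-α^2 - 54/49*α + 94/343)*z + (-5/7*α^2
      - 1/49*α - 100/343)) * hs + ((42*α^2 + 600/49*α + 6/343)*z + (17/7*α^2 + 8/7*α - 190/343))*hz
      + ((94/49*α - 94/343)*z^3 + (-153/49*α + 306/343)*z^2 + (6*α + 110/343)*z + (2/49*α +
      53/343))*hα
  exact one_ne_zero hone

theorem minorCubic_leading_ne_zero {α : ℂ} (hα : 7 * α ^ 3 + 7 * α + 1 = 0) : -50*α^2 - 7*α + 1 ≠ 0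
    := by
  intro hs
  have hone : (1 : ℂ) = 0 := by
    linear_combination (127351/137101*α^2 - 17157/137101*α + 132300/137101) * hs +
      ((909650/137101*α + 4801/137101))*hα
  exact one_ne_zero hone

/-! ### The two nodes over the roots of `lineQuadratic` -/

theorem isPlaneSingular_of_lineQuadratic {α : ℂ} (hα : 7 * α ^ 3 + 7 * α + 1 = 0) {z : ℂ} (hz :
    lineQuadratic α z = 0) :
    IsPlaneSingular α ((z + 1) * (1 + α ^ 2)) z := by
  simp only [lineQuadratic] at hz
  have hX : ((z + 1) * (1 + α ^ 2)) ^ 2 = (132382/11261*α^2 - 18592/11261*α + 134546/11261)*z +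
    (238778/33783*α^2 - 33544/33783*α + 242818/33783) := by
    linear_combination ((-40205/33783*α^2 + 5656/33783*α - 40999/33783))*hz + ((33544/33783*α +
      52260/11261)*z^2 + (67088/33783*α - 8080/33783)*z + (33544/33783*α - 4040/33783))*hα
  obtain ⟨r, hr⟩ : ∃ r : ℂ, r = (132382/11261*α^2 - 18592/11261*α + 134546/11261)*z +
    (238778/33783*α^2 - 33544/33783*α + 242818/33783) := ⟨_, rfl⟩
  rw [← hr] at hX
  have hD : cubicForm α r z 1 = (32151088928/380430363*α^2 - 4463988544/380430363*α +
    229502412940/2663012541)*z + (18844448896/380430363*α^2 - 2642277968/380430363*α +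
    134510070572/2663012541) := by
    rw [hr]
    simp only [cubicForm, coeff₁, coeff₂, coeff₃, coeff₄]
    linear_combination ((84088/236481*α^2 - 1700/33783*α + 19196/236481)*z +
      (-7600390208/887670847*α^2 + 152031148/126810121*α - 7742162118/887670847))*hz +
      ((-420440/1655367*α - 15612/11261)*z^3 + (104536703440/18641087787*α +
      12730807468/380430363)*z^2 + (223277131400/18641087787*α - 4465215940/2663012541)*z +
      (38001951040/6213695929*α - 760155740/887670847))*hα
  have hE : cubicFormZ α r z 1 = (182186/78827*α^2 + 6200/11261*α + 140638/78827)*z +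
    (437582/236481*α^2 + 8744/33783*α + 440362/236481) := by
    rw [hr]
    simp only [cubicFormZ, coeff₁, coeff₂, coeff₃]
    linear_combination ((84088/78827*α^2 - 1700/11261*α + 19196/78827))*hz + ((-420440/551789*α -
      46836/11261)*z^2 + (-840880/551789*α + 17000/78827)*z + (-420440/551789*α + 8500/78827))*hα
  have hF : cubicFormW α r z 1 = (-2777414/78827*α^2 + 53512/11261*α - 2825762/78827)*z +
    (-4875586/236481*α^2 + 97904/33783*α - 4963766/236481) := by
    rw [hr]
    simp only [cubicFormW, coeff₂, coeff₃, coeff₄]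
    linear_combination ((375344/78827*α^2 - 7764/11261*α + 382416/78827))*hz + ((-1876720/551789*α
      - 1462556/78827)*z^2 + (-3753440/551789*α + 77640/78827)*z + (-1876720/551789*α +
      38820/78827))*hα
  have h2 : r ^ 2 = (6941134142202808/4284026317743*α^2 - 972499463548256/4284026317743*α +
    7077394187812808/4284026317743)*z + (12229874123455400/12852078953229*α^2 -
    1713488009252992/12852078953229*α + 12469949877203896/12852078953229) := by
    rw [hr]
    linear_combination ((-755400398941652/4284026317743*α^2 + 105836554039216/4284026317743*α -
      770228796031756/4284026317743))*hz + ((624149837777536/4284026317743*α +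
      974082468724032/1428008772581)*z^2 + (1180846052046976/4284026317743*α -
      179765786234944/4284026317743)*z + (1710435878262272/12852078953229*α -
      252562832690192/12852078953229))*hα
  refine ⟨?_, ?_, ?_⟩
  · rw [hX, axialZ, hD, hE, hr]
    simp only [linForm, coeff₅]
    linear_combination ((-17429888/33783*α^2 + 1922368/33783*α - 17737216/33783)*z^4 +
      (362796928256/126810121*α^2 - 50829072000/126810121*α + 369785956960/126810121)*z^3 +
      (5290926584674976/12852078953229*α^2 - 740401066439104/12852078953229*α +
      5395756986944128/12852078953229)*z^2 + (157185681048773083480/144727261092311769*α^2 -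
      154168850834757872312/1013090827646182383*α + 7853479269371263793288/7091635793523276681)*z +
      (803239667701472247128/434181783276935307*α^2 - 787778155336007432872/3039272482938547149*α +
      40131332099367741411304/21274907380569830043))*hz + ((12449920/33783*α + 22782144/11261)*z^6
      + (-497024890880/380430363*α - 4275569107712/380430363)*z^5 +
      (-8942825185845376/12852078953229*α - 8590442064206464/4284026317743)*z^4 +
      (-2319993745646968/1428008772581*α^3 + 977474061105024/1428008772581*α^2 -
      941624955008458028744/337696942548727461*α - 4091287869832627318048/1013090827646182383)*z^3
      + (-838792422681400/4284026317743*α^3 + 4780320639406304/4284026317743*α^2 -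
      965548227124988293528/434181783276935307*α - 43834959314190155699920/7091635793523276681)*z^2
      + (26093391495976664/12852078953229*α^3 + 4627487743184768/12852078953229*α^2 +
      4112948422433226805000/3039272482938547149*α + 7751372355173808008224/21274907380569830043)*z
      + (35862038081169880/38556236859687*α^3 - 449053187972512/12852078953229*α^2 +
      298870397158257019624/337696942548727461*α - 1569067359728871074704/21274907380569830043))*hα
  · have hP : polarForm α r z 1 = 0 := by
      rw [polarForm, hD, hF]
      simp only [linForm, coeff₅]
      linear_combination ((10804927840/126810121*α^2 - 1514408848/126810121*α +
        77108041172/887670847))*hz + ((-7717805600/126810121*α - 294965935280/887670847)*z^2 +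
        (-8907965428/380430363*α - 11179347860/887670847)*z + (-350074140/126810121*α -
        991141980/126810121))*hα
    rw [hX, axialW, hP, mul_zero]
  · have h5 : ((z + 1) * (1 + α ^ 2)) ^ 5 = (2755366705508679831824/144727261092311769*α^2 -
    386045729080495335040/144727261092311769*α + 2809454354062773326704/144727261092311769)*z +
    (539405286515317542832/48242420364103923*α^2 - 75574376293405351040/48242420364103923*α +
    549993774112316145584/48242420364103923) := by
      calc ((z + 1) * (1 + α ^ 2)) ^ 5 = ((((z + 1) * (1 + α ^ 2)) ^ 2) ^ 2) * ((z + 1) * (1 + α ^ 2)) := by ring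
        _ = _ := by
          rw [hX, h2]
          linear_combination ((-289868257931456222488/144727261092311769*α^2 +
            40612530212954542976/144727261092311769*α -
            295558350795751911128/144727261092311769))*hz +
            ((240547660626188367872/144727261092311769*α +
            125085628914903980672/16080806788034641)*z^2 +
            (467270789506404420992/144727261092311769*α -
            65467834282684872160/144727261092311769)*z + (75574376293405351040/48242420364103923*α
            - 10588487596998602752/48242420364103923))*hα
    rw [h5, hX, axialQ, hD, hr]
    simp only [linForm, coeff₅]
    linear_combination ((-8714944/33783*α^2 + 961184/33783*α - 8868608/33783)*z^3 +
      (241502008384/380430363*α^2 - 33805744448/380430363*α + 246038870336/380430363)*z^2 +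
      (-4674073093866680/12852078953229*α^2 + 655814035668688/12852078953229*α -
      4765561677544360/12852078953229)*z + (643231974558139629488/48242420364103923*α^2 -
      90121387790623219600/48242420364103923*α + 655858754528467688128/48242420364103923))*hz +
      ((6224960/33783*α + 11391072/11261)*z^5 + (-10767628480/126810121*α -
      957323777536/380430363)*z^4 + (4708399158676576/12852078953229*α +
      38744629009662992/29988184224201)*z^3 + (-1566957114308239227056/144727261092311769*α -
      52297653238447508865776/1013090827646182383)*z^2 +
      (-3218938825109248094272/144727261092311769*α + 3654478869782524715024/1013090827646182383)*z
      + (-526362082049713303568/48242420364103923*α + 583190858016350206736/337696942548727461))*hα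

theorem planeHessian_ne_zero_of_lineQuadratic {α : ℂ} (hα : 7 * α ^ 3 + 7 * α + 1 = 0) {z : ℂ} (hz
    : lineQuadratic α z = 0) :
    planeHessian α ((z + 1) * (1 + α ^ 2)) z ≠ 0 := by
  intro hH
  simp only [lineQuadratic] at hz
  have hX : ((z + 1) * (1 + α ^ 2)) ^ 2 = (132382/11261*α^2 - 18592/11261*α + 134546/11261)*z +
    (238778/33783*α^2 - 33544/33783*α + 242818/33783) := by
    linear_combination ((-40205/33783*α^2 + 5656/33783*α - 40999/33783))*hz + ((33544/33783*α +
      52260/11261)*z^2 + (67088/33783*α - 8080/33783)*z + (33544/33783*α - 4040/33783))*hα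
  obtain ⟨r, hr⟩ : ∃ r : ℂ, r = (132382/11261*α^2 - 18592/11261*α + 134546/11261)*z +
    (238778/33783*α^2 - 33544/33783*α + 242818/33783) := ⟨_, rfl⟩
  rw [← hr] at hX
  have hD : cubicForm α r z 1 = (32151088928/380430363*α^2 - 4463988544/380430363*α +
    229502412940/2663012541)*z + (18844448896/380430363*α^2 - 2642277968/380430363*α +
    134510070572/2663012541) := by
    rw [hr]
    simp only [cubicForm, coeff₁, coeff₂, coeff₃, coeff₄]
    linear_combination ((84088/236481*α^2 - 1700/33783*α + 19196/236481)*z +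
      (-7600390208/887670847*α^2 + 152031148/126810121*α - 7742162118/887670847))*hz +
      ((-420440/1655367*α - 15612/11261)*z^3 + (104536703440/18641087787*α +
      12730807468/380430363)*z^2 + (223277131400/18641087787*α - 4465215940/2663012541)*z +
      (38001951040/6213695929*α - 760155740/887670847))*hα
  have hE : cubicFormZ α r z 1 = (182186/78827*α^2 + 6200/11261*α + 140638/78827)*z +
    (437582/236481*α^2 + 8744/33783*α + 440362/236481) := by
    rw [hr]
    simp only [cubicFormZ, coeff₁, coeff₂, coeff₃]
    linear_combination ((84088/78827*α^2 - 1700/11261*α + 19196/78827))*hz + ((-420440/551789*α -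
      46836/11261)*z^2 + (-840880/551789*α + 17000/78827)*z + (-420440/551789*α + 8500/78827))*hα
  have h3 : ((z + 1) * (1 + α ^ 2)) ^ 3 = (52453777448/380430363*α^2 - 7352137072/380430363*α +
    53484058096/380430363)*z + (30832821448/380430363*α^2 - 4320861104/380430363*α +
    31438339160/380430363) := by
    calc ((z + 1) * (1 + α ^ 2)) ^ 3 = ((z + 1) * (1 + α ^ 2)) ^ 2 * ((z + 1) * (1 + α ^ 2)) := by ring
      _ = _ := by
        rw [hX, hr]
        linear_combination ((-5511429734/380430363*α^2 + 772177000/380430363*α -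
          5619689590/380430363))*hz + ((4575629968/380430363*α + 7134812096/126810121)*z^2 +
          (2965497024/126810121*α - 415600120/126810121)*z + (4320861104/380430363*α -
          605517712/380430363))*hα
  have hQQ : axialQQ α r z = (928167107896/126810121*α^2 - 130069408672/126810121*α +
    946329701576/126810121)*z + (1634919163304/380430363*α^2 - 229088890912/380430363*α +
    1667030039080/380430363) := by
    rw [axialQQ, hr]
    simp only [linForm, coeff₅]
    linear_combination ((-1478428/11261*α^2 + 163058/11261*α - 1504496/11261)*z +
      (-313268012162/380430363*α^2 + 43890021070/380430363*α - 319527397546/380430363))*hz +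
      ((1056020/11261*α + 5797242/11261)*z^3 + (295113913150/380430363*α +
      404617540526/126810121)*z^2 + (483201255320/380430363*α - 66634736110/380430363)*z +
      (223762865830/380430363*α - 31350015050/380430363))*hα
  have hQZ : axialQZ α r z = (-237318056898943496/1428008772581*α^2 +
    33249560572966496/1428008772581*α - 241976903771373176/1428008772581)*z +
    (-1254644498030028056/12852078953229*α^2 + 175784134008519616/12852078953229*α -
    1279274006175490360/12852078953229) := by
    rw [axialQZ, hD, hE, hr]
    simp only [linForm, coeff₅]
    linear_combination ((21787360/33783*α^2 - 2402960/33783*α + 22171520/33783)*z^2 +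
      (605472682976/380430363*α^2 - 85007225968/380430363*α + 4325364387004/2663012541)*z +
      (256994736160477448/12852078953229*α^2 - 36010579301673724/12852078953229*α +
      1834279888459221220/89964552672603))*hz + ((-15562400/33783*α - 28477680/11261)*z^4 +
      (-260992286880/126810121*α - 2322514523984/380430363)*z^3 +
      (-223621622119533280/12852078953229*α - 2323918884357678680/29988184224201)*z^2 +
      (-372198054270569792/12852078953229*α + 357349799640239968/89964552672603)*z +
      (-176248156980234208/12852078953229*α + 166173587031629864/89964552672603))*hα
  have hZZ : axialZZ α r z = (644747953916278211559056/144727261092311769*α^2 -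
    90333610963922869416688/144727261092311769*α + 4601830160862398531913856/1013090827646182383)*z
    + (378662686653188864273648/144727261092311769*α^2 -
    53053238306141968373008/144727261092311769*α + 2702670657598350501728032/1013090827646182383)
    := by
    rw [axialZZ, hD, hE, hr]
    simp only [linForm, coeff₁, coeff₂, coeff₅]
    linear_combination ((-34859776/11261*α^2 + 3844736/11261*α - 35474432/11261)*z^3 +
      (476477028608/380430363*α^2 - 66166024960/380430363*α + 483345923200/380430363)*z^2 +
      (-29378375876899000184/629751868708221*α^2 + 588088715146425568/89964552672603*α -
      29954874488588763592/629751868708221)*z + (-410889216182613225203872/787959532613697409*α^2 +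
      8224055265974054977096/112565647516242487*α -
      418954852474128121739768/787959532613697409))*hz + ((24899840/11261*α + 136692864/11261)*z^5
      + (1342041854720/380430363*α - 681399706624/126810121)*z^4 +
      (176906055429908245120/4408263080957547*α + 37569911048854996288/209917289569407)*z^3 +
      (-10736382402616/887670847*α^3 - 324231432268552/6213695929*α^2 +
      21877976391079899259064344/49641450554662936767*α +
      13947494151216059833453480/7091635793523276681)*z^2 + (-15827898303216/887670847*α^3 -
      491271283044272/18641087787*α^2 + 4172950512791758129795696/5515716728295881863*α -
      966774265332870384578192/7091635793523276681)*z + (-50270922619000/7989037623*α^3 +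
      138728372372792/55923263361*α^2 + 1986530748552281482622616/5515716728295881863*α -
      347160663620549847065048/7091635793523276681))*hα
  have hs : (3316305764658118169812548415616/181085965240058092301*α^2 -
    464637170837816035179279746944/181085965240058092301*α +
    3381404617401038321552748900352/181085965240058092301)*z +
    (17528861881836644999772694687616/1629773687160522830709*α^2 -
    2455913709772103041355267906176/1629773687160522830709*α +
    17872952227869345228473205969664/1629773687160522830709) = 0 := by
    rw [planeHessian, hX, h3, hQQ, hQZ, hZZ] at hH
    linear_combination hH + ((29222370718513800348033246807808/14667963184444705476381*α^2 -
      4094254456650517721526448176896/14667963184444705476381*α +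
      29796003833759525979337146990464/14667963184444705476381))*hz +
      ((-24108817904037117817022592404864/14667963184444705476381*α -
      1395855410303424922554616554368/181085965240058092301)*z^2 +
      (-45664848696344219607283386285568/14667963184444705476381*α +
      6941777486948788763167606163456/14667963184444705476381)*z +
      (-22058461576579748747304102736000/14667963184444705476381*α +
      1085204977683149703104134086272/4889321061481568492127))*hα
  have hone : (1 : ℂ) = 0 := by
    linear_combination ((833297107/3012352*α^2 - 2815004607/42172928*α - 3180659/215168)*z +
      (-9169137/430336*α^2 - 5703627481/126518784*α - 951713/161376)) * hs +
      ((-1165343634746224945637351816151/1217622030274150612631924*α^2 +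
      40817764357186665487081133376/304405507568537653157981*α -
      1188217292631973569503170599717/1217622030274150612631924))*hz +
      ((-6168449529569845721930922096790576439/8523354211919054288423468*α +
      336100284307445681757947408406945775/1217622030274150612631924)*z^2 +
      (-14164085055144170096485671022342347751/38355093953635744297905606*α +
      745843943784937815637450546107310252/2739649568116838878421829)*z +
      (279041479580392497831812920179086497/8523354211919054288423468*α +
      2126400532322658380677525028697878047/32875794817402066541061948))*hα
  exact one_ne_zero hone

theorem sectionCubic_ne_zero_of_lineQuadratic {α : ℂ} (hα : 7 * α ^ 3 + 7 * α + 1 = 0) {z : ℂ} (hz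
    : lineQuadratic α z = 0) :
    sectionCubic ((z + 1) * (1 + α ^ 2)) z ≠ 0 := by
  intro hB
  simp only [lineQuadratic] at hz
  simp only [sectionCubic] at hB
  have hs : (229502412940/380430363*α^2 - 32151088928/380430363*α + 233966401484/380430363)*z +
    (134510070572/380430363*α^2 - 18844448896/380430363*α + 137152348540/380430363) = 0 := by
    linear_combination hB + ((267797/33783*α^2 - 197347/236481*α + 271753/33783)*z +
      (26458314527/380430363*α^2 - 25970410159/2663012541*α + 26978100187/380430363))*hz +
      ((1/7*α^3 - 1136287/236481*α - 350580/11261)*z^3 + (3/7*α^3 - 157122167723/2663012541*α -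
      102752972284/380430363)*z^2 + (3/7*α^3 - 275857151725/2663012541*α + 5503559864/380430363)*z
      + (1/7*α^3 - 131530711909/2663012541*α + 2642277968/380430363))*hα
  have hone : (1 : ℂ) = 0 := by
    linear_combination ((-221133/656*α^2 - 4347/82*α - 447/656)*z + (-23565/656*α^2 + 2639/82*α +
      2531/656)) * hs + ((1964384192033/20796859844*α^2 - 75061449001/5199214961*α +
      1994404946509/20796859844))*hz + ((150692541753390/5199214961*α +
      683008403938/5199214961)*z^2 + (2534633688566/126810121*α - 45145296076468/15597644883)*z +
      (9082936790200/5199214961*α - 29159208039197/15597644883))*hα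
  exact one_ne_zero hone

theorem coordinate_ne_zero_of_lineQuadratic {α : ℂ} (hα : 7 * α ^ 3 + 7 * α + 1 = 0) {z : ℂ} (hz :
    lineQuadratic α z = 0) :
    (z + 1) * (1 + α ^ 2) ≠ 0 := by
  intro hs
  simp only [lineQuadratic] at hz
  have hone : (1 : ℂ) = 0 := by
    linear_combination ((5/4*α^2 + 7*α + 3/4)*z + (5/4*α^2 - 7*α + 5/4)) * hs + ((-1/4*α^2 -
      1/4))*hz + ((1))*hα
  exact one_ne_zero hone

theorem lineQuadratic_separable {α : ℂ} (hα : 7 * α ^ 3 + 7 * α + 1 = 0) {z : ℂ} (hz :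
    lineQuadratic α z = 0) :
    (10*α^2 + 56*α + 6)*z + (10*α^2 + 8) ≠ 0 := by
  intro hs
  simp only [lineQuadratic] at hz
  have hone : (1 : ℂ) = 0 := by
    linear_combination ((5/42*α^2 + 2/3*α + 1/14)*z + (5/42*α^2 + 2/21)) * hs + ((-5/21*α^2 - 4/3*α
      - 1/7))*hz + ((20/21))*hα
  exact one_ne_zero hone

theorem lineQuadratic_leading_ne_zero {α : ℂ} (hα : 7 * α ^ 3 + 7 * α + 1 = 0) : 5*α^2 + 28*α + 3 ≠
    0 := by
  intro hs
  have hone : (1 : ℂ) = 0 := by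
    linear_combination (-38906/33783*α^2 + 4291/33783*α - 39592/33783) * hs + ((27790/33783*α +
      50853/11261))*hα
  exact one_ne_zero hone

/-- Keeps the group of two nodes disjoint from the group of three. -/
theorem minorCubic_ne_zero_of_lineQuadratic {α : ℂ} (hα : 7 * α ^ 3 + 7 * α + 1 = 0) {z : ℂ} (hz :
    lineQuadratic α z = 0) :
    minorCubic α z ≠ 0 := by
  intro hs
  simp only [lineQuadratic] at hz
  simp only [minorCubic] at hs
  have hone : (1 : ℂ) = 0 := by
    linear_combination ((36/7*α^2 + 1152/49*α + 603/343)*z + (95/7*α^2 - 61/7*α + 4670/343)) * hs +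
      ((291/7*α^2 + 3*α - 732/343)*z^2 + (-83/7*α^2 + 41/7*α - 435/343)*z + (19/7*α^2 - 22/7*α +
      934/343))*hz + ((345/49*α + 1593/343)*z^4 + (2363/49*α + 1888/343)*z^3 + (-327/49*α +
      271/343)*z^2 + (78/7*α - 24/343)*z + (1))*hα
  exact one_ne_zero hone

theorem minorQuadric_sq {α : ℂ} (hα : 7 * α ^ 3 + 7 * α + 1 = 0) {z : ℂ} (hz : minorCubic α z = 0) :
    minorQuadric α z ^ 2 = 4 * z * (1 + 2 * z + α ^ 2 * (1 + z)) := by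
  simp only [minorCubic] at hz
  simp only [minorQuadric]
  linear_combination ((8*α^2 - 4/7*α + 192/49)*z + (-4/7*α - 4/49))*hz + ((404/7*α + 592/49)*z^4 +
    (32/7*α + 596/49)*z^3 + (4*α)*z^2 + (8/7*α - 8/49)*z + (-4/49))*hα

/-- The quadric is the value of `q` forced at a root of `extraCubic`, so such a root cannot give a
singular point on the axis, where the condition `7x⁵ = 2A_q` is of no use. -/
theorem quadric_ne_zero_of_extraCubic {α : ℂ} (hα : 7 * α ^ 3 + 7 * α + 1 = 0) {z : ℂ} (hz :
    extraCubic α z = 0) :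
    (-12*α^2 + 8/7*α + 8)*z^2 + (-20*α^2 + 16/7*α - 20)*z + (-8*α^2 + 8/7*α - 8) ≠ 0 := by
  intro hs
  simp only [extraCubic] at hz
  have hone : (1 : ℂ) = 0 := by
    linear_combination ((14691/20*α^2 + 121467/140*α + 4281/40)*z^2 + (-287/5*α^2 + 19143/280*α +
      437/40)*z + (1397/40*α^2 + 293/35*α + 9/5)) * hs + ((-383*α^2 + 15577/35*α + 34247/490)*z +
      (157/2*α^2 + 1993/70*α + 586/245))*hz + ((130248/35*α - 132708/35)*z^4 + (-18419/10*α +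
      1694166/245)*z^3 + (-201097/7*α + 19849573/490)*z^2 + (-23648/5*α + 3852759/245)*z +
      (79897/35*α + 123317/245))*hα
  exact one_ne_zero hone

/-! ### Singular points at infinity and on the axis -/

theorem coeff₄_ne_zero {α : ℂ} (hα : 7 * α ^ 3 + 7 * α + 1 = 0) : coeff₄ α ≠ 0 := by
  intro hs
  simp only [coeff₄] at hs
  have hone : (1 : ℂ) = 0 := by
    linear_combination (-343/8*α^2) * hs + ((-7*α + 1))*hα
  exact one_ne_zero hone

/-- In the plane `w = 0`, on the conic `q = -a₁ z²` where the cofactor of `z` in `cubicForm`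
vanishes, `axialZ` equals `7 z⁶` times this number. -/
theorem sevenPlanes_unit₁ {α : ℂ} (hα : 7 * α ^ 3 + 7 * α + 1 = 0) : 64 + 80 * coeff₁ α + 24 *
    coeff₁ α ^ 2 + coeff₁ α ^ 3 ≠ 0 := by
  intro hs
  simp only [coeff₁] at hs
  have hone : (1 : ℂ) = 0 := by
    linear_combination (1830804739614481155/108048189797759855488*α^2 -
      62673424916213265/27012047449439963872*α + 898087568558380907/54024094898879927744) * hs +
      ((20587974997747185/1688252965589997742*α^5 + 139765120956865530/844126482794998871*α^4 +
      1004632515581436693/1688252965589997742*α^3 - 440328333869501931/1688252965589997742*α^2 -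
      2470006358211703500/844126482794998871*α + 62314475265177318/64932806368846067))*hα
  exact one_ne_zero hone

theorem singular_at_infinity {α : ℂ} (hα : 7 * α ^ 3 + 7 * α + 1 = 0) {q z : ℂ}
    (hZ : axialZ α q z 0 = 0) (hW : axialW α q z 0 = 0) : z = 0 ∧ q = 0 := by
  have hz : z = 0 := by
    by_contra hz
    rcases mul_eq_zero.mp hW with hD | hP
    · have hD' : z * (q + coeff₁ α * z ^ 2) = 0 := by
        rw [cubicForm] at hD
        linear_combination hD
      have hq : q = -(coeff₁ α * z ^ 2) := by
        linear_combination (mul_eq_zero.mp hD').resolve_left hz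
      have h6 : z ^ 6 * (64 + 80 * coeff₁ α + 24 * coeff₁ α ^ 2 + coeff₁ α ^ 3) = 0 := by
        rw [axialZ, hD, hq] at hZ
        linear_combination hZ / 7
      exact mul_ne_zero (pow_ne_zero 6 hz) (sevenPlanes_unit₁ hα) h6
    · have hP' : z * ((coeff₅ α + 2) * q + (coeff₅ α * coeff₁ α + 2 * coeff₂ α) * z ^ 2) = 0 := by
        simp only [polarForm, linForm, cubicForm, cubicFormW] at hP
        linear_combination hP
      obtain ⟨s, hs⟩ : ∃ s : ℂ, s = 49*α^2 - 7*α + 52 := ⟨_, rfl⟩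
      obtain ⟨t, ht⟩ : ∃ t : ℂ, t = 12*α^2 - 8/7*α + 12 := ⟨_, rfl⟩
      have hq : s * q = t * z ^ 2 := by
        have h := (mul_eq_zero.mp hP').resolve_left hz
        simp only [coeff₅, coeff₁, coeff₂] at h
        rw [hs, ht]
        linear_combination h + z ^ 2 * (((12*α + 372/7))*hα)
      -- As in `elimination`, `axialZ` is multiplied by `s³` and `s q = t z²` is inserted; nothing
      -- is divided by `s`.
      have h6 : z ^ 6 * (448 * s ^ 3 - 560 * t * s ^ 2 + 168 * t ^ 2 * s - 7 * t ^ 3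
          + s * ((t + s * coeff₁ α) ^ 2
            + 2 * (t + s * coeff₁ α) * (t + 3 * s * coeff₁ α))) = 0 := by
        simp only [axialZ, linForm, cubicForm, cubicFormZ] at hZ
        have e : s ^ 3 * (448 * z ^ 6 - 560 * z ^ 4 * q + 168 * z ^ 2 * q ^ 2 - 7 * q ^ 3
            + z ^ 2 * (q + coeff₁ α * z ^ 2) ^ 2
            + 2 * z ^ 2 * (q + coeff₁ α * z ^ 2) * (q + 3 * coeff₁ α * z ^ 2)) = 0 := by
          linear_combination s ^ 3 * hZ
        have e' : 448 * s ^ 3 * z ^ 6 - 560 * z ^ 4 * (s * q) * s ^ 2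
            + 168 * z ^ 2 * (s * q) ^ 2 * s - 7 * (s * q) ^ 3
            + s * z ^ 2 * (s * q + s * coeff₁ α * z ^ 2) ^ 2
            + 2 * s * z ^ 2 * (s * q + s * coeff₁ α * z ^ 2)
              * (s * q + 3 * s * coeff₁ α * z ^ 2) = 0 := by
          linear_combination e
        rw [hq] at e'
        linear_combination e'
      have h1 := (mul_eq_zero.mp h6).resolve_left (pow_ne_zero 6 hz)
      rw [hs, ht] at h1
      simp only [coeff₁] at h1
      have hone : (1 : ℂ) = 0 := by
        linear_combination (1735120040773/104966536838765760*α^2 +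
          74858514912223/104966536838765760*α + 10456168873451/104966536838765760) * h1 +
          ((-4166023217895973/728934283602540*α^9 - 2512083847876057/8475980041890*α^8 -
          29235420848014192/12713970062835*α^7 - 2956569762693348074/546700712701905*α^6 -
          32049380698246254749/6560408552422860*α^5 - 98477266818043627843/6560408552422860*α^4 -
          418520042409348817/145786856720508*α^3 - 31895485777301421289/2186802850807620*α^2 -
          1980740616646709141/6560408552422860*α - 7677857277246129403/1640102138105715))*hα
      exact one_ne_zero hone
  refine ⟨hz, ?_⟩
  have h3 : q ^ 3 = 0 := by
    rw [axialZ, linForm, cubicForm, cubicFormZ, hz] at hZ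
    linear_combination -hZ / 7
  exact pow_eq_zero_iff (by norm_num) |>.mp h3

/-- With `q = 0`, a zero of `cubicForm` would force `z = 0` and then `coeff₄ α = 0`. On the other
branch the last three factors of `elimination` each force a nonzero `q`, and only `z + 1` survives.
-/
theorem axis_singular {α : ℂ} (hα : 7 * α ^ 3 + 7 * α + 1 = 0) {z : ℂ}
    (hZ : axialZ α 0 z 1 = 0) (hW : axialW α 0 z 1 = 0) : z = -1 := by
  rcases mul_eq_zero.mp hW with hD | hP
  · exfalso
    have hz : z = 0 := by
      rw [axialZ, hD] at hZ
      have h6 : z ^ 6 = 0 := by linear_combination hZ / 448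
      exact pow_eq_zero_iff (by norm_num) |>.mp h6
    rw [cubicForm, hz] at hD
    exact coeff₄_ne_zero hα (by linear_combination hD)
  · rcases mul_eq_zero.mp (elimination hα hP hZ) with h | h
    · rcases mul_eq_zero.mp h with h | h
      · rcases mul_eq_zero.mp h with h | h
        · linear_combination h
        · exact absurd (eq_of_lineQuadratic hα hP h).symm
            (pow_ne_zero 2 (coordinate_ne_zero_of_lineQuadratic hα h))
      · exact absurd ((minorQuadric_sq hα h).trans (eq_of_minorCubic hα hP h).symm)
          (pow_ne_zero 2 (coordinate_ne_zero_of_minorCubic hα h))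
    · exact absurd (eq_of_extraCubic hα hP h).symm (quadric_ne_zero_of_extraCubic hα h)

theorem axis_isSingular {α : ℂ} (hα : 7 * α ^ 3 + 7 * α + 1 = 0) : axialZ α 0 (-1) 1 = 0 ∧ axialW α
    0 (-1) 1 = 0 := by
  constructor
  · simp only [axialZ, linForm, cubicForm, cubicFormZ, coeff₁, coeff₂, coeff₃, coeff₄, coeff₅]
    linear_combination ((-2688*α + 448))*hα
  · refine mul_eq_zero_of_right _ ?_
    rw [polarForm_eq hα]
    ring

theorem axis_axialQ_ne_zero (α : ℂ) : axialQ α 0 (-1) 1 ≠ 0 := by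
  norm_num [axialQ]

theorem axis_axialZZ_ne_zero {α : ℂ} (hα : 7 * α ^ 3 + 7 * α + 1 = 0) : axialZZ α 0 (-1) ≠ 0 := by
  intro hs
  simp only [axialZZ, linForm, cubicForm, cubicFormZ, coeff₁, coeff₂, coeff₃, coeff₄, coeff₅] at hs
  have hone : (1 : ℂ) = 0 := by
    linear_combination (-7/32*α^2) * hs + ((28*α^4 + 2936*α^3 - 532*α^2 - 7*α + 1))*hα
  exact one_ne_zero hone

/-! ### The nine base nodes -/

/-- The quadratic factor of `cubicForm α 1 c t` when `c` is one of the slopes of `sectionCubic`. -/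
noncomputable def quadFactor (α c t : ℂ) : ℂ :=
  (-(8 / 7) * α ^ 2 + 8 / 49 * α - 8 / 7) * t ^ 2 + (-8 / 7 * (1 + α ^ 2) + (-20 / 7 + 16 / 49 * α
    - 20 / 7 * α ^ 2) * c) * t + (-1 / 7 + (-12 / 7 - 8 / 7 * α ^ 2) * c + (-8 / 7 + 8 / 49 * α -
    12 / 7 * α ^ 2) * c ^ 2)

/-- With `c = z/x` and `t = w/x`, the linear factor is the line `z + w + 7αx = 0`. Since `7α(1 + α²)
= -1`, it is the line `x = (1 + α²)(z + w)`, which also carries the nodes of `lineQuadratic`. -/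
theorem cubicForm_factor {α : ℂ} (hα : 7 * α ^ 3 + 7 * α + 1 = 0) {c : ℂ} (hc : 8 * c ^ 3 + 4 * c ^
    2 - 4 * c - 1 = 0) (t : ℂ) :
    cubicForm α 1 c t = (t + 7 * α + c) * quadFactor α c t := by
  simp only [cubicForm, quadFactor, coeff₁, coeff₂, coeff₃, coeff₄]
  linear_combination (-α)*hc + (12/7*c^2 + 20/7*c*t + 8/7*c + 8/7*t^2 + 8/7*t)*hα

/-- The discriminant of `quadFactor` in `t`. The field is left general because nonvanishing is
needed over `ℂ` and positivity over `ℝ`. -/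
theorem quadFactor_disc {K : Type*} [Field K] [CharZero K] {α : K}
    (hα : 7 * α ^ 3 + 7 * α + 1 = 0) (c : K) :
    (-8 / 7 * (1 + α ^ 2) + (-20 / 7 + 16 / 49 * α - 20 / 7 * α ^ 2) * c) ^ 2 - 4 * (-(8 / 7) * α ^
      2 + 8 / 49 * α - 8 / 7) * (-1 / 7 + (-12 / 7 - 8 / 7 * α ^ 2) * c + (-8 / 7 + 8 / 49 * α - 12
      / 7 * α ^ 2) * c ^ 2) =
      16 / 343 * (14 - 2 * α + 14 * α ^ 2) * (1 - 2 * c + 9 / 2 * c ^ 2) := by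
  linear_combination (16/343*α*c^2 + 64/343*α*c + 64/343*α)*hα

theorem quadFactor_disc_ne_zero {α : ℂ} (hα : 7 * α ^ 3 + 7 * α + 1 = 0) {c : ℂ} (hc : 8 * c ^ 3 +
    4 * c ^ 2 - 4 * c - 1 = 0) :
    16 / 343 * (14 - 2 * α + 14 * α ^ 2) * (1 - 2 * c + 9 / 2 * c ^ 2) ≠ 0 := by
  have h1 : (14 - 2 * α + 14 * α ^ 2) * (7/2*α^2) = 1 := by
    linear_combination ((7*α - 1))*hα
  have h2 : (1 - 2 * c + 9 / 2 * c ^ 2) * (-64/169*c^2 + 272/1183*c + 792/1183) = 1 := by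
    linear_combination (-36/169*c + 391/1183)*hc
  exact mul_ne_zero (mul_ne_zero (by norm_num) (left_ne_zero_of_mul_eq_one h1))
    (left_ne_zero_of_mul_eq_one h2)

theorem quadFactor_line_ne_zero {α : ℂ} (hα : 7 * α ^ 3 + 7 * α + 1 = 0) {c : ℂ} (hc : 8 * c ^ 3 +
    4 * c ^ 2 - 4 * c - 1 = 0) :
    quadFactor α c (-7 * α - c) ≠ 0 := by
  have h : quadFactor α c (-7 * α - c) * (-20/41*c^2 + 14/41*c - 15/41) = 1 := by
    simp only [quadFactor]
    linear_combination (-10/41*α^3 - 10/41*α - 10/287*c + 22/287)*hc + (160/41*α*c^2 - 112/41*α*c +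
      120/41*α - 32/41*c^2 + 124/287*c - 250/287)*hα
  exact left_ne_zero_of_mul_eq_one h

/-- At fixed slope `cubicFormW` is the `t`-derivative of `cubicForm`, so the claim is that each line
of slope `c` meets the cubic in distinct points. A multiple root would be shared by the linear and
the quadratic factor, or be a double root of the latter. -/
theorem cubicFormW_ne_zero {α : ℂ} (hα : 7 * α ^ 3 + 7 * α + 1 = 0) {c t : ℂ} (hc : 8 * c ^ 3 + 4 *
    c ^ 2 - 4 * c - 1 = 0) (ht : cubicForm α 1 c t = 0) :
    cubicFormW α 1 c t ≠ 0 := by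
  intro hW
  have hder : cubicFormW α 1 c t =
      quadFactor α c t + (t + 7 * α + c) * (2 * (-(8 / 7) * α ^ 2 + 8 / 49 * α - 8 / 7) * t + (-8 /
        7 * (1 + α ^ 2) + (-20 / 7 + 16 / 49 * α - 20 / 7 * α ^ 2) * c)) := by
    simp only [cubicFormW, quadFactor, coeff₂, coeff₃, coeff₄]
    linear_combination (20/7*c + 16/7*t + 8/7)*hα
  rw [hder] at hW
  rw [cubicForm_factor hα hc] at ht
  rcases mul_eq_zero.mp ht with h | h
  · rw [h, zero_mul, add_zero] at hW
    rw [show t = -7 * α - c by linear_combination h] at hW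
    exact quadFactor_line_ne_zero hα hc hW
  · rw [h, zero_add] at hW
    rcases mul_eq_zero.mp hW with h' | h'
    · rw [show t = -7 * α - c by linear_combination h'] at h
      exact quadFactor_line_ne_zero hα hc h
    · refine quadFactor_disc_ne_zero hα hc ?_
      rw [← quadFactor_disc hα c]
      simp only [quadFactor] at h
      -- This is `b² - 4ac = (2at + b)² - 4a(at² + bt + c)` at a double root `t`.
      linear_combination (2 * (-(8 / 7) * α ^ 2 + 8 / 49 * α - 8 / 7) * t + (-8 / 7 * (1 + α ^ 2) +
        (-20 / 7 + 16 / 49 * α - 20 / 7 * α ^ 2) * c)) * h' - 4 * (-(8 / 7) * α ^ 2 + 8 / 49 * α -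
        8 / 7) * h

/-- As `t = w/x`, this keeps the intersection points out of the plane at infinity. -/
theorem slope_root_ne_zero {α : ℂ} (hα : 7 * α ^ 3 + 7 * α + 1 = 0) {c t : ℂ} (hc : 8 * c ^ 3 + 4 *
    c ^ 2 - 4 * c - 1 = 0) (ht : cubicForm α 1 c t = 0) :
    t ≠ 0 := by
  rintro rfl
  have h1 : (c + coeff₁ α * c ^ 3) * (1423579133442407340/844126482794998871*α^2*c^2 +
    1857535918078399524/844126482794998871*α^2*c - 433898382293381607/844126482794998871*α^2 +
    2232864213710654580/844126482794998871*α*c^2 + 757549208910723264/844126482794998871*α*c -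
    1134091605209125962/844126482794998871*α + 7035084535645845476/844126482794998871*c^2 +
    3515206134367254166/844126482794998871*c - 3526191135191817113/844126482794998871) = 1 := by
    simp only [coeff₁]
    linear_combination (-305052671451944430/844126482794998871*α^4*c^2 -
      245517075290827683/844126482794998871*α^4*c + 63210426696594828/844126482794998871*α^4 -
      1872997401004029090/844126482794998871*α^3*c^2 - 1045460294627082831/844126482794998871*α^3*c
      + 508588779532365567/1688252965589997742*α^3 - 3898182118703870382/844126482794998871*α^2*c^2
      + 188381307002553924/844126482794998871*α^2*c + 63210426696594828/844126482794998871*α^2 -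
      7210491983815819692/844126482794998871*α*c^2 + 53557442683353462/844126482794998871*α*c +
      40511453957359875/129865612737692134*α - 1005012076520835068/844126482794998871*c^2 +
      333733350809796/844126482794998871*c + 1760908505523192823/1688252965589997742)*hc +
      (-219994668485947782/844126482794998871*α*c^2 + 1046375927935947/844126482794998871*α*c +
      9030060956656404/844126482794998871*α - 1010288019796727364/844126482794998871*c^2 -
      4040390794621671/844126482794998871*c + 72655539933195081/1688252965589997742)*hα
  refine left_ne_zero_of_mul_eq_one h1 ?_
  rw [cubicForm] at ht
  linear_combination ht

/-- If `L` vanished at a base node, `L D²` would vanish to third order there and the quadratic part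
of the equation would degenerate. -/
theorem linForm_ne_zero {α : ℂ} (hα : 7 * α ^ 3 + 7 * α + 1 = 0) {c t : ℂ} (hc : 8 * c ^ 3 + 4 * c
    ^ 2 - 4 * c - 1 = 0) (ht : cubicForm α 1 c t = 0) :
    linForm α c t ≠ 0 := by
  intro h
  have hct : c = -(49 * α ^ 2 - 7 * α + 50) * t := by
    simp only [linForm, coeff₅] at h
    linear_combination h
  simp only [cubicForm, coeff₁, coeff₂, coeff₃, coeff₄] at ht
  rw [hct] at hc ht
  have hone : (1 : ℂ) = 0 := by
    linear_combination ((20784*α^2 - 2912*α + 21192)*t^2 + (-200*α^2 + 28*α - 204)*t + (-4*α^2 -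
      4)) * ht + ((-1)) * hc + ((-598828608*α^7 - 2396960832*α^6 - 727393632*α^5 - 7762005216*α^4 +
      431405312*α^3 - 8189732768*α^2 + 553350048*α - 2819722752)*t^5 + (5762400*α^7 + 23066064*α^6
      + 7004256*α^5 + 74701424*α^4 - 4144176*α^3 + 78826720*α^2 - 5322480*α + 27143424)*t^4 +
      (115248*α^7 + 477456*α^6 + 204624*α^5 + 1496992*α^4 - 76392*α^3 + 1609384*α^2 - 171200*α +
      570632)*t^3 + (-28*α + 4)*t^2 + (-28*α + 4)*t) * hα
  exact one_ne_zero hone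

/-- The nodes of the plane section at which `sectionCubic` and `cubicForm` vanish. -/
def IsBaseNode (α x z : ℂ) : Prop := sectionCubic x z = 0 ∧ cubicForm α (x ^ 2) z 1 = 0

theorem slope_of_isBaseNode {α x z : ℂ} (hx : x ≠ 0) (h : IsBaseNode α x z) :
    8 * (z / x) ^ 3 + 4 * (z / x) ^ 2 - 4 * (z / x) - 1 = 0 ∧ cubicForm α 1 (z / x) x⁻¹ = 0 := by
  obtain ⟨hB, hD⟩ := h
  constructor
  · have e : 8 * (z / x) ^ 3 + 4 * (z / x) ^ 2 - 4 * (z / x) - 1 = sectionCubic x z / x ^ 3 := by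
      rw [sectionCubic]
      field_simp
    rw [e, hB, zero_div]
  · have e : cubicForm α 1 (z / x) x⁻¹ = cubicForm α (x ^ 2) z 1 / x ^ 3 := by
      rw [cubicForm, cubicForm]
      field_simp
    rw [e, hD, zero_div]

theorem isBaseNode_of_slope {α c t : ℂ} (hc : 8 * c ^ 3 + 4 * c ^ 2 - 4 * c - 1 = 0) (ht :
    cubicForm α 1 c t = 0)
    (h0 : t ≠ 0) : IsBaseNode α t⁻¹ (c / t) := by
  constructor
  · have e : sectionCubic t⁻¹ (c / t) = (8 * c ^ 3 + 4 * c ^ 2 - 4 * c - 1) / t ^ 3 := by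
      rw [sectionCubic]
      field_simp
    rw [e, hc, zero_div]
  · have e : cubicForm α (t⁻¹ ^ 2) (c / t) 1 = cubicForm α 1 c t / t ^ 3 := by
      rw [cubicForm, cubicForm]
      field_simp
    rw [e, ht, zero_div]

/-- On `y = 0` the equation is `(x - z) B² - L D²`, which vanishes doubly where `B = D = 0`. -/
theorem IsBaseNode.isPlaneSingular {α x z : ℂ} (h : IsBaseNode α x z) :
    IsPlaneSingular α x z := by
  obtain ⟨hB, hD⟩ := h
  rw [sectionCubic] at hB
  refine ⟨?_, ?_, ?_⟩
  · rw [axialZ, hD]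
    linear_combination 7 * (8 * z ^ 3 - 4 * z ^ 2 * x - 4 * z * x ^ 2 + x ^ 3) * hB
  · rw [axialW, hD, zero_mul]
  · rw [axialQ, hD]
    linear_combination 7 * (4 * z ^ 2 - 2 * z * x - x ^ 2) * hB

/-- Where `B = D = 0`, the Hessian of `(x - z) B² - L D²` is `2(x - z) ∇B ∇Bᵀ - 2L ∇D ∇Dᵀ`; its
determinant is `-4(x - z) L` times the square of the Jacobian of `(B, D)`. The three equations for
the entries give exactly this shape. -/
theorem planeHessian_of_isBaseNode {α x z : ℂ} (h : IsBaseNode α x z) :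
    x ^ 2 * planeHessian α x z =
      4 * (x - z) * linForm α z 1 *
        ((4 * z ^ 2 - 8 * z * x - 3 * x ^ 2) * cubicFormZ α (x ^ 2) z 1
          - (24 * z ^ 2 + 8 * z * x - 4 * x ^ 2) * (2 * (z + 1) * x)) ^ 2 := by
  obtain ⟨hB, hD⟩ := h
  rw [sectionCubic] at hB
  have hxx : 35 * x ^ 5 - 4 * x ^ 2 * axialQQ α (x ^ 2) z =
      2 * (x - z) * (4 * z ^ 2 - 8 * z * x - 3 * x ^ 2) ^ 2
        - 2 * linForm α z 1 * (2 * (z + 1) * x) ^ 2 := by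
    rw [axialQQ]
    linear_combination (4*z^2 - 22*z*x - 17*x^2) * hB
  have hxz : -2 * x * axialQZ α (x ^ 2) z =
      2 * (x - z) * (4 * z ^ 2 - 8 * z * x - 3 * x ^ 2) * (24 * z ^ 2 + 8 * z * x - 4 * x ^ 2)
        - 2 * linForm α z 1 * (2 * (z + 1) * x) * cubicFormZ α (x ^ 2) z 1 := by
    rw [axialQZ, hD]
    linear_combination (24*z^2 + 64*z*x - 18*x^2) * hB
  have hzz : -axialZZ α (x ^ 2) z =
      2 * (x - z) * (24 * z ^ 2 + 8 * z * x - 4 * x ^ 2) ^ 2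
        - 2 * linForm α z 1 * cubicFormZ α (x ^ 2) z 1 ^ 2 := by
    rw [axialZZ, hD]
    linear_combination (-192*z^2 + 48*z*x + 32*x^2) * hB
  have e : x ^ 2 * planeHessian α x z =
      -((35 * x ^ 5 - 4 * x ^ 2 * axialQQ α (x ^ 2) z) * (-axialZZ α (x ^ 2) z)
        - (-2 * x * axialQZ α (x ^ 2) z) ^ 2) := by
    rw [planeHessian]
    ring
  rw [e, hxx, hxz, hzz]
  ring

theorem IsBaseNode.planeHessian_ne_zero {α : ℂ} (hα : 7 * α ^ 3 + 7 * α + 1 = 0) {x z : ℂ} (hx : x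
    ≠ 0)
    (h : IsBaseNode α x z) : planeHessian α x z ≠ 0 := by
  obtain ⟨hc, ht⟩ := slope_of_isBaseNode hx h
  have hW := cubicFormW_ne_zero hα hc ht
  have hL := linForm_ne_zero hα hc ht
  have hL' : linForm α z 1 ≠ 0 := by
    intro h0
    apply hL
    have e : linForm α (z / x) x⁻¹ = linForm α z 1 / x := by
      rw [linForm, linForm]
      field_simp
    rw [e, h0, zero_div]
  have hW' : cubicFormW α (x ^ 2) z 1 ≠ 0 := by
    intro h0
    apply hW
    have e : cubicFormW α 1 (z / x) x⁻¹ = cubicFormW α (x ^ 2) z 1 / x ^ 2 := by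
      rw [cubicFormW, cubicFormW]
      field_simp
    rw [e, h0, zero_div]
  have hH := planeHessian_of_isBaseNode h
  obtain ⟨hB, hD⟩ := h
  rw [sectionCubic] at hB
  have hA : x - z ≠ 0 := by
    intro h0
    rw [show z = x by linear_combination -h0] at hB
    exact pow_ne_zero 3 hx (by linear_combination hB / 7)
  have hBz : 24 * z ^ 2 + 8 * z * x - 4 * x ^ 2 ≠ 0 := by
    intro h0
    exact pow_ne_zero 4 hx (by linear_combination (-12/7*z - 1/7*x) * hB + (4/7*z^2 + 1/7*z*x -
      3/14*x^2) * h0)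
  -- Euler's relations `x B_x + z B_z = 3B = 0` and `x D_x + z D_z + D_w = 3D = 0` give `x (B_x D_z
  -- - B_z D_x) = B_z D_w`: transversality follows from the simplicity of the slopes and of the
  -- roots `t`.
  have hJ : x * ((4 * z ^ 2 - 8 * z * x - 3 * x ^ 2) * cubicFormZ α (x ^ 2) z 1
      - (24 * z ^ 2 + 8 * z * x - 4 * x ^ 2) * (2 * (z + 1) * x)) =
      (24 * z ^ 2 + 8 * z * x - 4 * x ^ 2) * cubicFormW α (x ^ 2) z 1 := by
    rw [cubicForm] at hD
    rw [cubicFormZ, cubicFormW]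
    linear_combination 3 * (x ^ 2 + 3 * coeff₁ α * z ^ 2 + 2 * coeff₂ α * z + coeff₃ α) * hB
      - 3 * (24 * z ^ 2 + 8 * z * x - 4 * x ^ 2) * hD
  intro h0
  rw [h0, mul_zero] at hH
  have hJ0 := right_ne_zero_of_mul (hJ ▸ mul_ne_zero hBz hW')
  exact mul_ne_zero (mul_ne_zero (mul_ne_zero (by norm_num) hA) hL') (pow_ne_zero 2 hJ0) hH.symm

theorem isPlaneSingular_cases {α : ℂ} (hα : 7 * α ^ 3 + 7 * α + 1 = 0) {x z : ℂ} (hx : x ≠ 0) (h :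
    IsPlaneSingular α x z) :
    IsBaseNode α x z ∨ (lineQuadratic α z = 0 ∧ x = (z + 1) * (1 + α ^ 2)) ∨
      (minorCubic α z = 0 ∧ x = minorQuadric α z) := by
  obtain ⟨hZ, hW, hQ⟩ := h
  rcases mul_eq_zero.mp hW with hD | hP
  · left
    refine ⟨?_, hD⟩
    have hprod : sectionCubic x z * (8 * z ^ 3 - 4 * z ^ 2 * x - 4 * z * x ^ 2 + x ^ 3) = 0 := by
      rw [axialZ, hD] at hZ
      rw [sectionCubic]
      linear_combination hZ / 7
    -- By Euler's relation the point lies on the surface, and where `D = 0` the equation is `(x - z)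
    -- B²`.
    have hsq : (x - z) * sectionCubic x z ^ 2 = 0 := by
      have he := axial_euler α (x ^ 2) z 1
      rw [hZ, hW, axial, hD] at he
      rw [sectionCubic]
      linear_combination x ^ 2 * hQ / 7 + he / 7
    rcases mul_eq_zero.mp hsq with hA | hB
    · exfalso
      rw [show z = x by linear_combination -hA, sectionCubic] at hprod
      exact pow_ne_zero 6 hx (by linear_combination hprod / 7)
    · exact pow_eq_zero_iff (two_ne_zero) |>.mp hB
  · right
    -- `q` fixes `x` only up to sign; the sign is settled by `7x⁵ = 2A_q`, whose right side depends
    -- on `x²` alone.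
    have hxq : ∀ y : ℂ, x ^ 2 = y ^ 2 → 7 * y ^ 5 = 2 * axialQ α (y ^ 2) z 1 → x = y := by
      intro y hy hyQ
      rw [← hy, ← hQ] at hyQ
      refine mul_left_cancel₀ (pow_ne_zero 4 hx) ?_
      linear_combination -hyQ / 7 - y * (x ^ 2 + y ^ 2) * hy
    rcases mul_eq_zero.mp (elimination hα hP hZ) with h | h
    · rcases mul_eq_zero.mp h with h | h
      · rcases mul_eq_zero.mp h with h | h
        · exfalso
          rw [show z = -1 by linear_combination h] at hP
          exact pow_ne_zero 2 hx (eq_zero_of_eq_neg_one hα hP)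
        · exact Or.inl ⟨h, hxq _ (eq_of_lineQuadratic hα hP h)
            (isPlaneSingular_of_lineQuadratic hα h).2.2⟩
      · exact Or.inr ⟨h, hxq _ ((eq_of_minorCubic hα hP h).trans (minorQuadric_sq hα h).symm)
            (isPlaneSingular_of_minorCubic hα h).2.2⟩
    · refine absurd h (extraCubic_ne_zero hα hP ?_)
      linear_combination (7 * x ^ 5 + 2 * axialQ α (x ^ 2) z 1) * hQ

theorem IsPlaneSingular.planeHessian_ne_zero {α : ℂ} (hα : 7 * α ^ 3 + 7 * α + 1 = 0) {x z : ℂ} (hx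
    : x ≠ 0)
    (h : IsPlaneSingular α x z) : planeHessian α x z ≠ 0 := by
  rcases isPlaneSingular_cases hα hx h with hb | ⟨hz, rfl⟩ | ⟨hz, rfl⟩
  · exact hb.planeHessian_ne_zero hα hx
  · exact planeHessian_ne_zero_of_lineQuadratic hα hz
  · exact planeHessian_ne_zero_of_minorCubic hα hz

/-! ### Counting the nodes in the plane -/

/-- A complex polynomial without multiple roots has as many roots as its degree. -/
theorem card_roots_of_derivative_ne_zero {P : Polynomial ℂ} (hP : P ≠ 0)
    (h : ∀ z, P.eval z = 0 → P.derivative.eval z ≠ 0) : P.roots.toFinset.card = P.natDegree := by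
  have hnd : P.roots.Nodup := by
    rw [Multiset.nodup_iff_count_le_one]
    intro z
    rw [Polynomial.count_roots]
    by_contra! hlt
    obtain ⟨h0, h1⟩ := (Polynomial.one_lt_rootMultiplicity_iff_isRoot hP).mp hlt
    exact h z h0 h1
  rw [Multiset.toFinset_card_of_nodup hnd, ← (IsAlgClosed.splits P).natDegree_eq_card_roots]

theorem exists_finset_cubic {a b c d : ℂ} (ha : a ≠ 0)
    (h : ∀ z, a * z ^ 3 + b * z ^ 2 + c * z + d = 0 → 3 * a * z ^ 2 + 2 * b * z + c ≠ 0) :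
    ∃ s : Finset ℂ, s.card = 3 ∧ ∀ z, z ∈ s ↔ a * z ^ 3 + b * z ^ 2 + c * z + d = 0 := by
  obtain ⟨P, hP⟩ : ∃ P : Polynomial ℂ, P = .C a * .X ^ 3 + .C b * .X ^ 2 + .C c * .X + .C d :=
    ⟨_, rfl⟩
  have hdeg : P.natDegree = 3 := by rw [hP]; exact Polynomial.natDegree_cubic ha
  have h0 : P ≠ 0 := by
    rintro rfl
    simp at hdeg
  have heval : ∀ z, P.eval z = a * z ^ 3 + b * z ^ 2 + c * z + d := by
    intro z
    simp [hP]
  refine ⟨P.roots.toFinset, ?_, fun z => ?_⟩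
  · rw [card_roots_of_derivative_ne_zero h0, hdeg]
    intro z hz hz'
    refine h z (by rw [← heval, hz]) ?_
    rw [← hz', hP]
    simp
    ring
  · rw [Multiset.mem_toFinset, Polynomial.mem_roots h0, Polynomial.IsRoot, heval]

theorem exists_finset_quadratic {a b c : ℂ} (ha : a ≠ 0)
    (h : ∀ z, a * z ^ 2 + b * z + c = 0 → 2 * a * z + b ≠ 0) :
    ∃ s : Finset ℂ, s.card = 2 ∧ ∀ z, z ∈ s ↔ a * z ^ 2 + b * z + c = 0 := by
  obtain ⟨P, hP⟩ : ∃ P : Polynomial ℂ, P = .C a * .X ^ 2 + .C b * .X + .C c := ⟨_, rfl⟩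
  have hdeg : P.natDegree = 2 := by rw [hP]; exact Polynomial.natDegree_quadratic ha
  have h0 : P ≠ 0 := by
    rintro rfl
    simp at hdeg
  have heval : ∀ z, P.eval z = a * z ^ 2 + b * z + c := by
    intro z
    simp [hP]
  refine ⟨P.roots.toFinset, ?_, fun z => ?_⟩
  · rw [card_roots_of_derivative_ne_zero h0, hdeg]
    intro z hz hz'
    refine h z (by rw [← heval, hz]) ?_
    rw [← hz', hP]
    simp
    ring
  · rw [Multiset.mem_toFinset, Polynomial.mem_roots h0, Polynomial.IsRoot, heval]

theorem exists_finset_baseNodes {α : ℂ} (hα : 7 * α ^ 3 + 7 * α + 1 = 0) :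
    ∃ S : Finset (ℂ × ℂ), S.card = 9 ∧ ∀ p, p ∈ S ↔ p.1 ≠ 0 ∧ IsBaseNode α p.1 p.2 := by
  obtain ⟨s, hs, hmem⟩ := exists_finset_cubic (a := 8) (b := 4) (c := -4) (d := -1) (by norm_num)
    (by
      intro z hz hz'
      have : (1 : ℂ) = 0 := by
        linear_combination (-(12 / 7) * z - 1 / 7) * hz
          + (4 / 7 * z ^ 2 + 1 / 7 * z - 3 / 14) * hz'
      exact one_ne_zero this)
  have hslope : ∀ c, c ∈ s ↔ 8 * c ^ 3 + 4 * c ^ 2 - 4 * c - 1 = 0 := by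
    intro c
    rw [hmem, neg_mul, ← sub_eq_add_neg, ← sub_eq_add_neg]
  have hfib : ∀ c, ∃ r : Finset ℂ, c ∈ s → r.card = 3 ∧ ∀ t, t ∈ r ↔ cubicForm α 1 c t = 0 := by
    intro c
    by_cases hc : c ∈ s
    · have hc' := (hslope c).mp hc
      have hform : ∀ t, cubicForm α 1 c t = coeff₄ α * t ^ 3 + coeff₃ α * c * t ^ 2
          + (1 + coeff₂ α * c ^ 2) * t + (c + coeff₁ α * c ^ 3) := by
        intro t
        rw [cubicForm]
        ring
      obtain ⟨r, hr, hr'⟩ := exists_finset_cubic (coeff₄_ne_zero hα)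
        (b := coeff₃ α * c) (c := 1 + coeff₂ α * c ^ 2) (d := c + coeff₁ α * c ^ 3) (by
          intro t ht ht'
          rw [← hform] at ht
          refine cubicFormW_ne_zero hα hc' ht ?_
          rw [← ht', cubicFormW]
          ring)
      exact ⟨r, fun _ => ⟨hr, fun t => by rw [hr', hform]⟩⟩
    · exact ⟨∅, fun h => absurd h hc⟩
  choose r hr using hfib
  refine ⟨(s.sigma r).image fun ct => (ct.2⁻¹, ct.1 / ct.2), ?_, ?_⟩
  · rw [Finset.card_image_of_injOn, Finset.card_sigma,
      Finset.sum_congr rfl (fun c hc => (hr c hc).1), Finset.sum_const, hs, smul_eq_mul]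
    rintro ⟨c, t⟩ h ⟨c', t'⟩ h' he
    obtain ⟨hc, ht⟩ := Finset.mem_sigma.mp (Finset.mem_coe.mp h)
    obtain ⟨hc', -⟩ := Finset.mem_sigma.mp (Finset.mem_coe.mp h')
    obtain ⟨h1, h2⟩ := Prod.mk.inj he
    have h0 : t ≠ 0 := slope_root_ne_zero hα ((hslope c).mp hc) (((hr c hc).2 t).mp ht)
    have htt : t = t' := inv_injective h1
    subst htt
    have hcc : c = c' := by
      rwa [div_left_inj' h0] at h2
    subst hcc
    rfl
  · rintro ⟨x, z⟩
    rw [Finset.mem_image]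
    constructor
    · rintro ⟨⟨c, t⟩, h, he⟩
      obtain ⟨hc, ht⟩ := Finset.mem_sigma.mp h
      rw [← he]
      have hc' := (hslope c).mp hc
      have ht' := ((hr c hc).2 t).mp ht
      have h0 := slope_root_ne_zero hα hc' ht'
      exact ⟨inv_ne_zero h0, isBaseNode_of_slope hc' ht' h0⟩
    · rintro ⟨hx, hb⟩
      obtain ⟨hc, ht⟩ := slope_of_isBaseNode hx hb
      have hc' := (hslope _).mpr hc
      refine ⟨⟨z / x, x⁻¹⟩, Finset.mem_sigma.mpr ⟨hc', ((hr _ hc').2 _).mpr ht⟩, ?_⟩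
      have hx' : x ≠ 0 := hx
      simp [hx']

theorem exists_finset_planeSingular {α : ℂ} (hα : 7 * α ^ 3 + 7 * α + 1 = 0) :
    ∃ S : Finset (ℂ × ℂ), S.card = 14 ∧ ∀ p, p ∈ S ↔ p.1 ≠ 0 ∧ IsPlaneSingular α p.1 p.2 := by
  obtain ⟨S₁, hS₁, hmem₁⟩ := exists_finset_baseNodes hα
  obtain ⟨s₂, hs₂, hmem₂⟩ := exists_finset_quadratic (lineQuadratic_leading_ne_zero hα)
    (b := 8 + 10 * α ^ 2) (c := 5 * (1 + α ^ 2)) (by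
      intro z hz hz'
      refine lineQuadratic_separable hα (z := z) (by rw [← hz, lineQuadratic]; ring) ?_
      rw [← hz']
      ring)
  obtain ⟨s₃, hs₃, hmem₃⟩ := exists_finset_cubic (minorCubic_leading_ne_zero hα)
    (b := 1 - 7 * α - 3 * α ^ 2) (c := -(1 + 3 * α ^ 2)) (d := -(1 + α ^ 2)) (by
      intro z hz hz'
      refine minorCubic_separable hα (z := z) (by rw [← hz, minorCubic]; ring) ?_
      rw [← hz']
      ring)
  have hmem₂' : ∀ z, z ∈ s₂ ↔ lineQuadratic α z = 0 := by
    intro z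
    rw [hmem₂, lineQuadratic]
    ring_nf
  have hmem₃' : ∀ z, z ∈ s₃ ↔ minorCubic α z = 0 := by
    intro z
    rw [hmem₃, minorCubic]
    ring_nf
  obtain ⟨S₂, hS₂⟩ : ∃ S₂, S₂ = s₂.image fun z => ((z + 1) * (1 + α ^ 2), z) := ⟨_, rfl⟩
  obtain ⟨S₃, hS₃⟩ : ∃ S₃, S₃ = s₃.image fun z => (minorQuadric α z, z) := ⟨_, rfl⟩
  have hc₂ : S₂.card = 2 := by
    rw [hS₂, Finset.card_image_of_injective _ fun a b h => (Prod.mk.inj h).2, hs₂]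
  have hc₃ : S₃.card = 3 := by
    rw [hS₃, Finset.card_image_of_injective _ fun a b h => (Prod.mk.inj h).2, hs₃]
  have hm₂ : ∀ p, p ∈ S₂ ↔ lineQuadratic α p.2 = 0 ∧ p.1 = (p.2 + 1) * (1 + α ^ 2) := by
    rintro ⟨x, z⟩
    rw [hS₂, Finset.mem_image]
    constructor
    · rintro ⟨y, hy, he⟩
      rw [← he]
      exact ⟨(hmem₂' y).mp hy, rfl⟩
    · rintro ⟨hz, hx⟩
      exact ⟨z, (hmem₂' z).mpr hz, Prod.ext hx.symm rfl⟩
  have hm₃ : ∀ p, p ∈ S₃ ↔ minorCubic α p.2 = 0 ∧ p.1 = minorQuadric α p.2 := by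
    rintro ⟨x, z⟩
    rw [hS₃, Finset.mem_image]
    constructor
    · rintro ⟨y, hy, he⟩
      rw [← he]
      exact ⟨(hmem₃' y).mp hy, rfl⟩
    · rintro ⟨hz, hx⟩
      exact ⟨z, (hmem₃' z).mpr hz, Prod.ext hx.symm rfl⟩
  have hd₂₃ : Disjoint S₂ S₃ := by
    rw [Finset.disjoint_left]
    intro p h2 h3
    exact minorCubic_ne_zero_of_lineQuadratic hα ((hm₂ p).mp h2).1 ((hm₃ p).mp h3).1
  have hd₁ : Disjoint S₁ (S₂ ∪ S₃) := by
    rw [Finset.disjoint_left]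
    intro p h1 h
    have hB := ((hmem₁ p).mp h1).2.1
    rcases Finset.mem_union.mp h with h | h
    · obtain ⟨hz, hx⟩ := (hm₂ p).mp h
      exact sectionCubic_ne_zero_of_lineQuadratic hα hz (hx ▸ hB)
    · obtain ⟨hz, hx⟩ := (hm₃ p).mp h
      exact sectionCubic_ne_zero_of_minorCubic hα hz (hx ▸ hB)
  refine ⟨S₁ ∪ (S₂ ∪ S₃), ?_, fun p => ?_⟩
  · rw [Finset.card_union_of_disjoint hd₁, Finset.card_union_of_disjoint hd₂₃, hS₁, hc₂, hc₃]
  · rw [Finset.mem_union, Finset.mem_union, hmem₁, hm₂, hm₃]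
    constructor
    · rintro (⟨hx, hb⟩ | ⟨hz, hx⟩ | ⟨hz, hx⟩)
      · exact ⟨hx, hb.isPlaneSingular⟩
      · rw [hx]
        exact ⟨coordinate_ne_zero_of_lineQuadratic hα hz, isPlaneSingular_of_lineQuadratic hα hz⟩
      · rw [hx]
        exact ⟨coordinate_ne_zero_of_minorCubic hα hz, isPlaneSingular_of_minorCubic hα hz⟩
    · rintro ⟨hx, h⟩
      rcases isPlaneSingular_cases hα hx h with h | h | h
      · exact Or.inl ⟨hx, h⟩
      · exact Or.inr (Or.inl h)
      · exact Or.inr (Or.inr h)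

/-! ### Reality for the real root -/

/-- A real cubic (or quadratic) polynomial with positive discriminant has only real roots. -/
theorem im_eq_zero_of_cubic {a b c d : ℝ} {z : ℂ}
    (hz : (a : ℂ) * z ^ 3 + b * z ^ 2 + c * z + d = 0)
    (hd : 0 < 18 * a * b * c * d - 4 * b ^ 3 * d + b ^ 2 * c ^ 2 - 4 * a * c ^ 3
      - 27 * a ^ 2 * d ^ 2) : z.im = 0 := by
  by_contra ht
  obtain ⟨s, t⟩ := z
  have ht' : t ≠ 0 := ht
  have hre := congrArg Complex.re hz
  have him := congrArg Complex.im hz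
  simp [pow_succ] at hre him
  have hc : c = a * t ^ 2 - 3 * a * s ^ 2 - 2 * b * s := by
    refine mul_left_cancel₀ ht' ?_
    linear_combination him
  have hd' : d = -(a * (s ^ 3 - 3 * s * t ^ 2) + b * (s ^ 2 - t ^ 2) + c * s) := by
    linear_combination hre
  -- The discriminant in terms of a conjugate pair `s ± it`: eliminating the third root by means of
  -- the sum of the roots exhibits it as minus a square.
  have e : 18 * a * b * c * d - 4 * b ^ 3 * d + b ^ 2 * c ^ 2 - 4 * a * c ^ 3
      - 27 * a ^ 2 * d ^ 2 = -(2 * t * ((3 * a * s + b) ^ 2 + a ^ 2 * t ^ 2)) ^ 2 := by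
    rw [hd', hc]
    ring
  rw [e] at hd
  linarith [sq_nonneg (2 * t * ((3 * a * s + b) ^ 2 + a ^ 2 * t ^ 2))]

theorem im_eq_zero_of_quadratic {a b c : ℝ} {z : ℂ} (hz : (a : ℂ) * z ^ 2 + b * z + c = 0)
    (hd : 0 < b ^ 2 - 4 * a * c) : z.im = 0 := by
  by_contra ht
  obtain ⟨s, t⟩ := z
  have ht' : t ≠ 0 := ht
  have hre := congrArg Complex.re hz
  have him := congrArg Complex.im hz
  simp [pow_succ] at hre him
  have hb : b = -2 * a * s := by
    refine mul_left_cancel₀ ht' ?_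
    linear_combination him
  have e : b ^ 2 - 4 * a * c = -(2 * a * t) ^ 2 := by
    rw [hb] at hre ⊢
    linear_combination -4 * a * hre
  rw [e] at hd
  linarith [sq_nonneg (2 * a * t)]

theorem real_root_bounds {α : ℝ} (hα : 7 * α ^ 3 + 7 * α + 1 = 0) :
    -0.140106855 < α ∧ α < -0.14010685 + 0.000000005 := by
  constructor
  · by_contra! h
    -- With `β` the bound, `2(β³ - α³) = (β - α)(α² + (α + β)²) + (β - α)β²`; the hint is the first
    -- summand, so the cubic is compared at `α` and `β` by monotonicity.
    nlinarith [mul_nonneg (sub_nonneg.mpr h) (add_nonneg (sq_nonneg α) (sq_nonneg (α -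
      0.140106855)))]
  · by_contra! h
    nlinarith [mul_nonneg (sub_nonneg.mpr h) (add_nonneg (sq_nonneg α) (sq_nonneg (α -
      0.140106845)))]

theorem exists_unique_real_root : ∃ α : ℝ, 7 * α ^ 3 + 7 * α + 1 = 0 ∧
    ∀ r : ℝ, 7 * r ^ 3 + 7 * r + 1 = 0 → r = α := by
  have hcont : ContinuousOn (fun r : ℝ => 7 * r ^ 3 + 7 * r + 1) (Set.Icc (-1) 0) := by fun_prop
  obtain ⟨α, -, hα⟩ := intermediate_value_Icc (by norm_num) hcont
    (show (0 : ℝ) ∈ Set.Icc _ _ by constructor <;> norm_num)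
  refine ⟨α, hα, fun r hr => ?_⟩
  have h : (r - α) * (7 * (r ^ 2 + r * α + α ^ 2) + 7) = 0 := by
    linear_combination hr - hα
  rcases mul_eq_zero.mp h with h | h
  · linarith
  · nlinarith [sq_nonneg (r + α), sq_nonneg r, sq_nonneg α]

theorem isPlaneSingular_real {α : ℝ} (hα : 7 * α ^ 3 + 7 * α + 1 = 0) {x z : ℂ} (hx : x ≠ 0)
    (h : IsPlaneSingular α x z) : x.im = 0 ∧ z.im = 0 := by
  obtain ⟨hlo, hhi⟩ := real_root_bounds hα
  have hαc : 7 * (α : ℂ) ^ 3 + 7 * α + 1 = 0 := by exact_mod_cast hα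
  rcases isPlaneSingular_cases hαc hx h with h | ⟨hz, rfl⟩ | ⟨hz, rfl⟩
  · obtain ⟨hc, ht⟩ := slope_of_isBaseNode hx h
    have him : (z / x).im = 0 := by
      refine im_eq_zero_of_cubic (a := 8) (b := 4) (c := -4) (d := -1) ?_ (by norm_num)
      push_cast
      linear_combination hc
    obtain ⟨c, hcr⟩ : ∃ c : ℝ, z / x = c := ⟨(z / x).re, Complex.ext rfl him⟩
    rw [hcr] at hc ht
    have hti : (x⁻¹).im = 0 := by
      rw [cubicForm_factor hαc hc] at ht
      rcases mul_eq_zero.mp ht with h | h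
      · rw [show x⁻¹ = ((-7 * α - c : ℝ) : ℂ) by push_cast; linear_combination h]
        exact Complex.ofReal_im _
      · refine im_eq_zero_of_quadratic (a := -(8 / 7) * α ^ 2 + 8 / 49 * α - 8 / 7)
          (b := -8 / 7 * (1 + α ^ 2) + (-20 / 7 + 16 / 49 * α - 20 / 7 * α ^ 2) * c)
          (c := -1 / 7 + (-12 / 7 - 8 / 7 * α ^ 2) * c
            + (-8 / 7 + 8 / 49 * α - 12 / 7 * α ^ 2) * c ^ 2) ?_ ?_
        · rw [quadFactor] at h
          push_cast
          exact h
        · rw [quadFactor_disc hα c]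
          have h1 : 0 < 14 - 2 * α + 14 * α ^ 2 := by nlinarith [sq_nonneg α]
          have h2 : 0 < 1 - 2 * c + 9 / 2 * c ^ 2 := by nlinarith [sq_nonneg (9 * c - 2)]
          positivity
    have hxi : x.im = 0 := by
      rw [← inv_inv x, Complex.inv_im, hti, neg_zero, zero_div]
    refine ⟨hxi, ?_⟩
    rw [show z = c * x by rw [← hcr]; field_simp, Complex.mul_im, hxi, Complex.ofReal_im]
    ring
  · have hi : z.im = 0 := by
      refine im_eq_zero_of_quadratic (a := 3 + 28 * α + 5 * α ^ 2) (b := 8 + 10 * α ^ 2)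
        (c := 5 * (1 + α ^ 2)) ?_ ?_
      · rw [← hz, lineQuadratic]
        push_cast
        ring
      -- Modulo the equation of `α` the discriminant of `lineQuadratic` is the constant 84; that of
      -- `minorCubic` below becomes `(49α)²`.
      · have e : (8 + 10 * α ^ 2) ^ 2 - 4 * (3 + 28 * α + 5 * α ^ 2) * (5 * (1 + α ^ 2)) =
            84 := by
          linear_combination ((-80))*hα
        rw [e]
        nlinarith
    obtain ⟨r, rfl⟩ : ∃ r : ℝ, z = r := ⟨z.re, Complex.ext rfl hi⟩
    refine ⟨?_, hi⟩
    rw [show ((r : ℂ) + 1) * (1 + (α : ℂ) ^ 2) = (((r + 1) * (1 + α ^ 2) : ℝ) : ℂ) by push_cast; rfl]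
    exact Complex.ofReal_im _
  · have hi : z.im = 0 := by
      refine im_eq_zero_of_cubic (a := 1 - 7 * α - 50 * α ^ 2) (b := 1 - 7 * α - 3 * α ^ 2)
        (c := -(1 + 3 * α ^ 2)) (d := -(1 + α ^ 2)) ?_ ?_
      · rw [← hz, minorCubic]
        push_cast
        ring
      · have e : 18 * (1 - 7 * α - 50 * α ^ 2) * (1 - 7 * α - 3 * α ^ 2) * (-(1 + 3 * α ^ 2))
              * (-(1 + α ^ 2)) - 4 * (1 - 7 * α - 3 * α ^ 2) ^ 3 * (-(1 + α ^ 2))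
              + (1 - 7 * α - 3 * α ^ 2) ^ 2 * (-(1 + 3 * α ^ 2)) ^ 2
              - 4 * (1 - 7 * α - 50 * α ^ 2) * (-(1 + 3 * α ^ 2)) ^ 3
              - 27 * (1 - 7 * α - 50 * α ^ 2) ^ 2 * (-(1 + α ^ 2)) ^ 2 =
            2401*α^2 := by
          linear_combination ((-9261*α^5 - 9261*α^3 - 637*α^2))*hα
        rw [e]
        nlinarith
    obtain ⟨r, rfl⟩ : ∃ r : ℝ, z = r := ⟨z.re, Complex.ext rfl hi⟩
    refine ⟨?_, hi⟩
    rw [show minorQuadric α r = (((4 + 100 / 7 * α + 2 * α ^ 2) * r ^ 2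
      + (2 + 4 / 7 * α + 2 * α ^ 2) * r + 2 / 7 * α : ℝ) : ℂ) by rw [minorQuadric]; push_cast; rfl]
    exact Complex.ofReal_im _

/-! ### Projective points, affine charts and Hessians -/

section Projective

variable {ι K : Type*} [Field K]

theorem eval_smul_of_isHomogeneous {F : MvPolynomial ι K} {n : ℕ} (hF : F.IsHomogeneous n) (c : K)
    (v : ι → K) : eval (c • v) F = c ^ n * eval v F := by
  rw [eval_eq, eval_eq, Finset.mul_sum]
  refine Finset.sum_congr rfl fun d hd => ?_
  have hdeg : ∑ i ∈ d.support, d i = n := by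
    rw [← Finsupp.degree_apply, Finsupp.degree_eq_weight_one]
    exact hF (mem_support_iff.mp hd)
  simp only [Pi.smul_apply, smul_eq_mul, mul_pow, Finset.prod_mul_distrib,
    Finset.prod_pow_eq_pow_sum, hdeg]
  ring

/-- Rescaling a vector multiplies the homogeneous form and its partial derivatives by powers of a
unit, so any representative may replace `rep`. -/
theorem isSingularPoint_mk {F : MvPolynomial ι K} {n : ℕ} (hF : F.IsHomogeneous n)
    {v : ι → K} (hv : v ≠ 0) :
    IsSingularPoint F (Projectivization.mk K v hv) ↔
      eval v F = 0 ∧ ∀ j, eval v (pderiv j F) = 0 := by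
  obtain ⟨a, ha⟩ := Projectivization.exists_smul_eq_mk_rep K v hv
  rw [IsSingularPoint, ← ha, Units.smul_def, eval_smul_of_isHomogeneous hF]
  refine and_congr ?_ (forall_congr' fun j => ?_)
  · simp
  · rw [eval_smul_of_isHomogeneous hF.pderiv]
    simp

theorem affineCoord_mk (i : ι) {v : ι → K} (hv : v ≠ 0) (hi : v i = 1) :
    affineCoord i (Projectivization.mk K v hv) = fun j : {j : ι // j ≠ i} => v j := by
  obtain ⟨a, ha⟩ := Projectivization.exists_smul_eq_mk_rep K v hv
  ext j
  rw [affineCoord, ← ha]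
  simp [Units.smul_def, hi]

variable [DecidableEq ι]

theorem eval_dehomogenize (i : ι) (F : MvPolynomial ι K) {v : ι → K} (hv : v i = 1) :
    eval (fun j : {j : ι // j ≠ i} => v j) (dehomogenize i F) = eval v F := by
  rw [dehomogenize]
  induction F using MvPolynomial.induction_on with
  | C a => simp
  | add p q hp hq => simp only [map_add, hp, hq]
  | mul_X p k hp =>
    rw [map_mul, map_mul, map_mul, hp, aeval_X, eval_X]
    congr 1
    by_cases hk : k = i
    · rw [dif_pos hk, map_one, hk, hv]
    · rw [dif_neg hk, eval_X]

theorem pderiv_dehomogenize (i : ι) (j : {j : ι // j ≠ i}) (F : MvPolynomial ι K) :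
    pderiv j (dehomogenize i F) = dehomogenize i (pderiv (j : ι) F) := by
  simp only [dehomogenize]
  induction F using MvPolynomial.induction_on with
  | C a => simp
  | add p q hp hq => simp only [map_add, hp, hq]
  | mul_X p k hp =>
    have hX : pderiv j ((if h : k = i then 1 else X ⟨k, h⟩ : MvPolynomial {j : ι // j ≠ i} K)) =
        aeval (fun j => if h : j = i then 1 else X ⟨j, h⟩)
          (pderiv (j : ι) (X k : MvPolynomial ι K)) := by
      by_cases hk : k = i
      · rw [dif_pos hk, pderiv_one, pderiv_X_of_ne (by rw [hk]; exact j.2.symm), map_zero]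
      · rw [dif_neg hk]
        by_cases hkj : k = j
        · subst hkj
          rw [pderiv_X_self (R := K) (j : ι), map_one]
          exact pderiv_X_self _
        · rw [pderiv_X_of_ne hkj, map_zero,
            pderiv_X_of_ne (fun h => hkj (congrArg Subtype.val h))]
    rw [map_mul, aeval_X, pderiv_mul, pderiv_mul, map_add, map_mul, map_mul, hp, hX, aeval_X]

theorem hessianAt_dehomogenize (i : ι) (F : MvPolynomial ι K) {v : ι → K} (hv : v i = 1)
    (j k : {j : ι // j ≠ i}) :
    hessianAt (dehomogenize i F) (fun j : {j : ι // j ≠ i} => v j) j k =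
      eval v (pderiv (j : ι) (pderiv (k : ι) F)) := by
  rw [hessianAt, Matrix.of_apply, pderiv_dehomogenize, pderiv_dehomogenize,
    eval_dehomogenize i _ hv]

end Projective

/-! ### Partial derivatives, homogeneity and symmetry of the septic -/

theorem pderiv_ofNat {ι : Type*} (i : ι) (n : ℕ) [n.AtLeastTwo] :
    pderiv i (ofNat(n) : MvPolynomial ι ℂ) = 0 := by
  rw [← map_ofNat (C : ℂ →+* MvPolynomial ι ℂ) n, pderiv_C]

theorem septic_eq (α : ℂ) :
    septic α = X 0 * (X 0 ^ 6 - 3 * 7 * X 0 ^ 4 * X 1 ^ 2 + 5 * 7 * X 0 ^ 2 * X 1 ^ 4 - 7 * X 1 ^ 6)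
      + 7 * X 2 * ((X 0 ^ 2 + X 1 ^ 2) ^ 3 - 2 ^ 3 * X 2 ^ 2 * (X 0 ^ 2 + X 1 ^ 2) ^ 2
        + 2 ^ 4 * X 2 ^ 4 * (X 0 ^ 2 + X 1 ^ 2)) - 2 ^ 6 * X 2 ^ 7
      - (X 2 + C (coeff₅ α) * X 3) * ((X 2 + X 3) * (X 0 ^ 2 + X 1 ^ 2) + C (coeff₁ α) * X 2 ^ 3
        + C (coeff₂ α) * X 2 ^ 2 * X 3 + C (coeff₃ α) * X 2 * X 3 ^ 2
        + C (coeff₄ α) * X 3 ^ 3) ^ 2 :=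
  rfl

theorem eval_septic (α : ℂ) (v : Fin 4 → ℂ) :
    eval v (septic α) = v 0 ^ 7 - 21 * v 0 ^ 5 * v 1 ^ 2 + 35 * v 0 ^ 3 * v 1 ^ 4
      - 7 * v 0 * v 1 ^ 6 - axial α (v 0 ^ 2 + v 1 ^ 2) (v 2) (v 3) := by
  simp [septic_eq, axial, linForm, cubicForm]
  ring

theorem eval_pderiv_zero (α : ℂ) (v : Fin 4 → ℂ) :
    eval v (pderiv 0 (septic α)) = 7 * (v 0 ^ 6 - 15 * v 0 ^ 4 * v 1 ^ 2 + 15 * v 0 ^ 2 * v 1 ^ 4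
      - v 1 ^ 6) - 2 * v 0 * axialQ α (v 0 ^ 2 + v 1 ^ 2) (v 2) (v 3) := by
  simp [septic_eq, axialQ, linForm, cubicForm, pderiv_X, pderiv_ofNat]
  ring

theorem eval_pderiv_one (α : ℂ) (v : Fin 4 → ℂ) :
    eval v (pderiv 1 (septic α)) = -7 * (6 * v 0 ^ 5 * v 1 - 20 * v 0 ^ 3 * v 1 ^ 3
      + 6 * v 0 * v 1 ^ 5) - 2 * v 1 * axialQ α (v 0 ^ 2 + v 1 ^ 2) (v 2) (v 3) := by
  simp [septic_eq, axialQ, linForm, cubicForm, pderiv_X, pderiv_ofNat]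
  ring

theorem eval_pderiv_two (α : ℂ) (v : Fin 4 → ℂ) :
    eval v (pderiv 2 (septic α)) = -axialZ α (v 0 ^ 2 + v 1 ^ 2) (v 2) (v 3) := by
  simp [septic_eq, axialZ, linForm, cubicForm, cubicFormZ, pderiv_X, pderiv_ofNat]
  ring

theorem eval_pderiv_three (α : ℂ) (v : Fin 4 → ℂ) :
    eval v (pderiv 3 (septic α)) = -axialW α (v 0 ^ 2 + v 1 ^ 2) (v 2) (v 3) := by
  simp [septic_eq, axialW, polarForm, linForm, cubicForm, cubicFormW, pderiv_X, pderiv_ofNat]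
  ring

theorem eval_pderiv_zero_zero (α : ℂ) {v : Fin 4 → ℂ} (hv : v 3 = 1) :
    eval v (pderiv 0 (pderiv 0 (septic α))) =
      42 * (v 0 ^ 5 - 10 * v 0 ^ 3 * v 1 ^ 2 + 5 * v 0 * v 1 ^ 4)
      - 2 * axialQ α (v 0 ^ 2 + v 1 ^ 2) (v 2) 1 - 4 * v 0 ^ 2 * axialQQ α (v 0 ^ 2 + v 1 ^ 2) (v
        2) := by
  simp [septic_eq, axialQ, linForm, cubicForm, axialQQ, pderiv_X, pderiv_ofNat, hv]
  ring

theorem eval_pderiv_zero_one (α : ℂ) {v : Fin 4 → ℂ} (hv : v 3 = 1) :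
    eval v (pderiv 0 (pderiv 1 (septic α))) =
      -42 * (5 * v 0 ^ 4 * v 1 - 10 * v 0 ^ 2 * v 1 ^ 3 + v 1 ^ 5)
      - 4 * v 0 * v 1 * axialQQ α (v 0 ^ 2 + v 1 ^ 2) (v 2) := by
  simp [septic_eq, axialQQ, linForm, pderiv_X, pderiv_ofNat, hv]
  ring

theorem eval_pderiv_one_zero (α : ℂ) {v : Fin 4 → ℂ} (hv : v 3 = 1) :
    eval v (pderiv 1 (pderiv 0 (septic α))) =
      -42 * (5 * v 0 ^ 4 * v 1 - 10 * v 0 ^ 2 * v 1 ^ 3 + v 1 ^ 5)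
      - 4 * v 0 * v 1 * axialQQ α (v 0 ^ 2 + v 1 ^ 2) (v 2) := by
  simp [septic_eq, axialQQ, linForm, pderiv_X, pderiv_ofNat, hv]
  ring

theorem eval_pderiv_one_one (α : ℂ) {v : Fin 4 → ℂ} (hv : v 3 = 1) :
    eval v (pderiv 1 (pderiv 1 (septic α))) =
      -42 * (v 0 ^ 5 - 10 * v 0 ^ 3 * v 1 ^ 2 + 5 * v 0 * v 1 ^ 4)
      - 2 * axialQ α (v 0 ^ 2 + v 1 ^ 2) (v 2) 1 - 4 * v 1 ^ 2 * axialQQ α (v 0 ^ 2 + v 1 ^ 2) (v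
        2) := by
  simp [septic_eq, axialQ, linForm, cubicForm, axialQQ, pderiv_X, pderiv_ofNat, hv]
  ring

theorem eval_pderiv_zero_two (α : ℂ) {v : Fin 4 → ℂ} (hv : v 3 = 1) :
    eval v (pderiv 0 (pderiv 2 (septic α))) =
      -2 * v 0 * axialQZ α (v 0 ^ 2 + v 1 ^ 2) (v 2) := by
  simp [septic_eq, axialQZ, linForm, cubicForm, cubicFormZ, pderiv_X, pderiv_ofNat, hv]
  ring

theorem eval_pderiv_two_zero (α : ℂ) {v : Fin 4 → ℂ} (hv : v 3 = 1) :
    eval v (pderiv 2 (pderiv 0 (septic α))) =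
      -2 * v 0 * axialQZ α (v 0 ^ 2 + v 1 ^ 2) (v 2) := by
  simp [septic_eq, axialQZ, linForm, cubicForm, cubicFormZ, pderiv_X, pderiv_ofNat, hv]
  ring

theorem eval_pderiv_one_two (α : ℂ) {v : Fin 4 → ℂ} (hv : v 3 = 1) :
    eval v (pderiv 1 (pderiv 2 (septic α))) =
      -2 * v 1 * axialQZ α (v 0 ^ 2 + v 1 ^ 2) (v 2) := by
  simp [septic_eq, axialQZ, linForm, cubicForm, cubicFormZ, pderiv_X, pderiv_ofNat, hv]
  ring

theorem eval_pderiv_two_one (α : ℂ) {v : Fin 4 → ℂ} (hv : v 3 = 1) :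
    eval v (pderiv 2 (pderiv 1 (septic α))) =
      -2 * v 1 * axialQZ α (v 0 ^ 2 + v 1 ^ 2) (v 2) := by
  simp [septic_eq, axialQZ, linForm, cubicForm, cubicFormZ, pderiv_X, pderiv_ofNat, hv]
  ring

theorem eval_pderiv_two_two (α : ℂ) {v : Fin 4 → ℂ} (hv : v 3 = 1) :
    eval v (pderiv 2 (pderiv 2 (septic α))) =
      -axialZZ α (v 0 ^ 2 + v 1 ^ 2) (v 2) := by
  simp [septic_eq, axialZZ, linForm, cubicForm, cubicFormZ, pderiv_X, pderiv_ofNat, hv]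
  ring

theorem septic_isHomogeneous (α : ℂ) : (septic α).IsHomogeneous 7 := by
  have hX (i : Fin 4) (n : ℕ) : (X i ^ n : MvPolynomial (Fin 4) ℂ).IsHomogeneous n := by
    simpa using (isHomogeneous_X ℂ i).pow n
  have hX1 (i : Fin 4) : (X i : MvPolynomial (Fin 4) ℂ).IsHomogeneous 1 := isHomogeneous_X ℂ i
  have hC (c : ℂ) {F : MvPolynomial (Fin 4) ℂ} {n : ℕ} (hF : F.IsHomogeneous n) :
      (C c * F).IsHomogeneous n := by
    simpa using (isHomogeneous_C (Fin 4) c).mul hF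
  have hq : (X 0 ^ 2 + X 1 ^ 2 : MvPolynomial (Fin 4) ℂ).IsHomogeneous 2 := (hX 0 2).add (hX 1 2)
  have e : septic α =
      X 0 * (X 0 ^ 6 - C 21 * (X 0 ^ 4 * X 1 ^ 2) + C 35 * (X 0 ^ 2 * X 1 ^ 4) - C 7 * X 1 ^ 6)
        + C 7 * (X 2 * ((X 0 ^ 2 + X 1 ^ 2) ^ 3 - C 8 * (X 2 ^ 2 * (X 0 ^ 2 + X 1 ^ 2) ^ 2)
          + C 16 * (X 2 ^ 4 * (X 0 ^ 2 + X 1 ^ 2)))) - C 64 * X 2 ^ 7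
        - (X 2 + C (coeff₅ α) * X 3) * ((X 2 + X 3) * (X 0 ^ 2 + X 1 ^ 2)
          + C (coeff₁ α) * X 2 ^ 3 + C (coeff₂ α) * (X 2 ^ 2 * X 3)
          + C (coeff₃ α) * (X 2 * X 3 ^ 2) + C (coeff₄ α) * X 3 ^ 3) ^ 2 := by
    rw [septic_eq]
    simp only [map_ofNat]
    ring
  rw [e]
  refine ((IsHomogeneous.add ?_ ?_).sub ?_).sub ?_
  · exact (hX1 0).mul ((((hX 0 6).sub (hC _ ((hX 0 4).mul (hX 1 2)))).add
      (hC _ ((hX 0 2).mul (hX 1 4)))).sub (hC _ (hX 1 6)))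
  · exact hC _ ((hX1 2).mul (((hq.pow 3).sub (hC _ ((hX 2 2).mul (hq.pow 2)))).add
      (hC _ ((hX 2 4).mul hq))))
  · exact hC _ (hX 2 7)
  · exact ((hX1 2).add (hC _ (hX1 3))).mul ((((((((hX1 2).add (hX1 3)).mul hq).add
      (hC _ (hX 2 3))).add (hC _ ((hX 2 2).mul (hX1 3)))).add
      (hC _ ((hX1 2).mul (hX 3 2)))).add (hC _ (hX 3 3))).pow 2)

theorem septic_ne_zero (α : ℂ) : septic α ≠ 0 := by
  intro h
  have h1 := eval_septic α ![1, 0, 0, 0]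
  rw [h] at h1
  simp [axial, linForm, cubicForm] at h1

theorem septic_isD7Symmetric (α : ℂ) : IsD7Symmetric (septic α) := by
  constructor
  · simp only [septic_eq, map_add, map_sub, map_mul, map_pow, aeval_X, aeval_C, map_ofNat,
      algebraMap_eq]
    simp only [Matrix.cons_val_zero, Matrix.cons_val_one, Matrix.cons_val]
    ring
  · obtain ⟨c, hc⟩ : ∃ c : ℂ, c = (Real.cos (2 * Real.pi / 7) : ℂ) := ⟨_, rfl⟩
    obtain ⟨s, hs⟩ : ∃ s : ℂ, s = (Real.sin (2 * Real.pi / 7) : ℂ) := ⟨_, rfl⟩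
    have hcs : c ^ 2 + s ^ 2 = 1 := by
      rw [hc, hs]
      exact_mod_cast Real.cos_sq_add_sin_sq _
    -- The rotation multiplies `x + iy` by this seventh root of unity, so it fixes `Re (x + iy)⁷`
    -- and `q`. The relations `hre` and `him` are the real and imaginary parts of `h7`.
    have h7 : (c + s * Complex.I) ^ 7 = 1 := by
      rw [hc, hs, Complex.ofReal_cos, Complex.ofReal_sin, ← Complex.exp_mul_I, ←
        Complex.exp_nat_mul,
        Complex.exp_eq_one_iff]
      refine ⟨1, ?_⟩
      push_cast
      ring
    have h7' : (c - s * Complex.I) ^ 7 = 1 := by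
      have h : (c + s * Complex.I) * (c - s * Complex.I) = 1 := by
        linear_combination hcs - s ^ 2 * Complex.I_sq
      have := congrArg (· ^ 7) h
      simpa [mul_pow, h7] using this
    have hI2 : Complex.I ^ 2 = -1 := Complex.I_sq
    have hI4 : Complex.I ^ 4 = 1 := Complex.I_pow_four
    have hI6 : Complex.I ^ 6 = -1 := by linear_combination Complex.I ^ 2 * hI4 + hI2
    have hI8 : Complex.I ^ 8 = 1 := by linear_combination (Complex.I ^ 4 + 1) * hI4
    have hre : c ^ 7 - 21 * c ^ 5 * s ^ 2 + 35 * c ^ 3 * s ^ 4 - 7 * c * s ^ 6 = 1 := by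
      linear_combination (h7 + h7') / 2 - 21 * c ^ 5 * s ^ 2 * hI2 - 35 * c ^ 3 * s ^ 4 * hI4
        - 7 * c * s ^ 6 * hI6
    have him : 7 * c ^ 6 * s - 35 * c ^ 4 * s ^ 3 + 21 * c ^ 2 * s ^ 5 - s ^ 7 = 0 := by
      linear_combination -Complex.I / 2 * (h7 - h7') + 7 * c ^ 6 * s * hI2
        + 35 * c ^ 4 * s ^ 3 * hI4 + 21 * c ^ 2 * s ^ 5 * hI6 + s ^ 7 * hI8
    have hcs' := congrArg (C : ℂ → MvPolynomial (Fin 4) ℂ) hcs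
    have hre' := congrArg (C : ℂ → MvPolynomial (Fin 4) ℂ) hre
    have him' := congrArg (C : ℂ → MvPolynomial (Fin 4) ℂ) him
    rw [← hc, ← hs]
    simp only [map_add, map_sub, map_mul, map_pow, map_one, map_ofNat, map_zero] at hcs' hre' him'
    simp only [septic_eq, map_add, map_sub, map_mul, map_pow, aeval_X, aeval_C, map_ofNat,
      algebraMap_eq]
    simp only [Matrix.cons_val_zero, Matrix.cons_val_one, Matrix.cons_val]
    generalize (C c : MvPolynomial (Fin 4) ℂ) = c at *
    generalize (C s : MvPolynomial (Fin 4) ℂ) = s at *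
    generalize (X 0 : MvPolynomial (Fin 4) ℂ) = x at *
    generalize (X 1 : MvPolynomial (Fin 4) ℂ) = y at *
    have hq : (c * x - s * y) ^ 2 + (s * x + c * y) ^ 2 = x ^ 2 + y ^ 2 := by
      linear_combination (x ^ 2 + y ^ 2) * hcs'
    rw [hq]
    linear_combination (x ^ 7 - 21 * x ^ 5 * y ^ 2 + 35 * x ^ 3 * y ^ 4 - 7 * x * y ^ 6) * hre'
      - (7 * x ^ 6 * y - 35 * x ^ 4 * y ^ 3 + 21 * x ^ 2 * y ^ 5 - y ^ 7) * him'

/-! ### Reduction to the plane `y = 0` by rotations -/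

/-- The point `(a : b : z : 1)`. -/
noncomputable def affinePoint (a b z : ℂ) : ℙ ℂ (Fin 4 → ℂ) :=
  Projectivization.mk ℂ ![a, b, z, 1] fun h => one_ne_zero (α := ℂ) (congrFun h 3)

theorem affinePoint_inj {a b z a' b' z' : ℂ} (h : affinePoint a b z = affinePoint a' b' z') :
    a = a' ∧ b = b' ∧ z = z' := by
  obtain ⟨t, ht⟩ := (Projectivization.mk_eq_mk_iff' ℂ _ _ _ _).mp h
  have h3 : t * 1 = 1 := congrFun ht 3
  rw [mul_one] at h3
  rw [h3, one_smul] at ht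
  exact ⟨(congrFun ht 0).symm, (congrFun ht 1).symm, (congrFun ht 2).symm⟩

/-- The singularity conditions at `(a : b : z : w)`. -/
def IsSingularAt (α a b z w : ℂ) : Prop :=
  a ^ 7 - 21 * a ^ 5 * b ^ 2 + 35 * a ^ 3 * b ^ 4 - 7 * a * b ^ 6
      - axial α (a ^ 2 + b ^ 2) z w = 0 ∧
    7 * (a ^ 6 - 15 * a ^ 4 * b ^ 2 + 15 * a ^ 2 * b ^ 4 - b ^ 6)
      - 2 * a * axialQ α (a ^ 2 + b ^ 2) z w = 0 ∧
    -7 * (6 * a ^ 5 * b - 20 * a ^ 3 * b ^ 3 + 6 * a * b ^ 5)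
      - 2 * b * axialQ α (a ^ 2 + b ^ 2) z w = 0 ∧
    axialZ α (a ^ 2 + b ^ 2) z w = 0 ∧ axialW α (a ^ 2 + b ^ 2) z w = 0

theorem isSingularPoint_septic_mk (α : ℂ) {v : Fin 4 → ℂ} (hv : v ≠ 0) :
    IsSingularPoint (septic α) (Projectivization.mk ℂ v hv) ↔
      IsSingularAt α (v 0) (v 1) (v 2) (v 3) := by
  have h4 (P : Fin 4 → Prop) : (∀ j, P j) ↔ P 0 ∧ P 1 ∧ P 2 ∧ P 3 := by
    simp [Fin.forall_fin_succ]
  rw [isSingularPoint_mk (septic_isHomogeneous α) hv, h4, eval_septic, eval_pderiv_zero,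
    eval_pderiv_one, eval_pderiv_two, eval_pderiv_three, neg_eq_zero, neg_eq_zero, IsSingularAt]

theorem isSingularPoint_affinePoint (α a b z : ℂ) :
    IsSingularPoint (septic α) (affinePoint a b z) ↔ IsSingularAt α a b z 1 :=
  isSingularPoint_septic_mk α _

/-- `F_x - i F_y` and `F_x + i F_y` are twice the derivatives of `(u⁷ + v⁷)/2 - A(uv, z, w)` with
respect to `u` and `v`. -/
theorem gradient_complex {α a b z w : ℂ} (h : IsSingularAt α a b z w) :
    7 * (a + b * Complex.I) ^ 6 =
        2 * (a - b * Complex.I) * axialQ α (a ^ 2 + b ^ 2) z w ∧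
      7 * (a - b * Complex.I) ^ 6 =
        2 * (a + b * Complex.I) * axialQ α (a ^ 2 + b ^ 2) z w := by
  obtain ⟨-, h0, h1, -, -⟩ := h
  have hI2 : Complex.I ^ 2 = -1 := Complex.I_sq
  have hI3 : Complex.I ^ 3 = -Complex.I := by linear_combination Complex.I * hI2
  have hI4 : Complex.I ^ 4 = 1 := Complex.I_pow_four
  have hI5 : Complex.I ^ 5 = Complex.I := by linear_combination Complex.I * hI4
  have hI6 : Complex.I ^ 6 = -1 := by linear_combination Complex.I ^ 2 * hI4 + hI2
  constructor
  · linear_combination h0 - Complex.I * h1 + 7 * (15 * a ^ 4 * b ^ 2 * hI2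
      + 20 * a ^ 3 * b ^ 3 * hI3 + 15 * a ^ 2 * b ^ 4 * hI4 + 6 * a * b ^ 5 * hI5 + b ^ 6 * hI6)
  · linear_combination h0 + Complex.I * h1 + 7 * (15 * a ^ 4 * b ^ 2 * hI2
      - 20 * a ^ 3 * b ^ 3 * hI3 + 15 * a ^ 2 * b ^ 4 * hI4 - 6 * a * b ^ 5 * hI5 + b ^ 6 * hI6)

theorem sq_add_sq_eq (a b : ℂ) :
    (a + b * Complex.I) * (a - b * Complex.I) = a ^ 2 + b ^ 2 := by
  linear_combination -b ^ 2 * Complex.I_sq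

theorem eq_zero_of_complex {a b : ℂ} (h : a + b * Complex.I = 0) (h' : a - b * Complex.I = 0) :
    a = 0 ∧ b = 0 := by
  refine ⟨by linear_combination (h + h') / 2, ?_⟩
  refine mul_right_cancel₀ Complex.I_ne_zero ?_
  linear_combination (h - h') / 2

/-- If `uv = 0`, one of `u`, `v` vanishes, and the gradient equation for the other one makes its
sixth power vanish. -/
theorem eq_zero_of_sq_add_sq {α a b z w : ℂ} (h : IsSingularAt α a b z w)
    (h0 : a ^ 2 + b ^ 2 = 0) : a = 0 ∧ b = 0 := by
  obtain ⟨hu, hv⟩ := gradient_complex h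
  rw [← sq_add_sq_eq] at h0
  rcases mul_eq_zero.mp h0 with h1 | h1
  · rw [h1, mul_zero, zero_mul] at hv
    exact eq_zero_of_complex h1 (pow_eq_zero_iff (by norm_num) |>.mp
      ((mul_eq_zero.mp hv).resolve_left (by norm_num)))
  · rw [h1, mul_zero, zero_mul] at hu
    exact eq_zero_of_complex (pow_eq_zero_iff (by norm_num) |>.mp
      ((mul_eq_zero.mp hu).resolve_left (by norm_num))) h1

theorem exists_affinePoint {α : ℂ} (hα : 7 * α ^ 3 + 7 * α + 1 = 0) {p : ℙ ℂ (Fin 4 → ℂ)}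
    (hp : IsSingularPoint (septic α) p) :
    ∃ a b z, p = affinePoint a b z ∧ IsSingularAt α a b z 1 := by
  induction p using Projectivization.ind with
  | h v hv =>
    have h := (isSingularPoint_septic_mk α hv).mp hp
    have h3 : v 3 ≠ 0 := by
      intro h3
      rw [h3] at h
      obtain ⟨hz, hq⟩ := singular_at_infinity hα h.2.2.2.1 h.2.2.2.2
      obtain ⟨h0, h1⟩ := eq_zero_of_sq_add_sq h hq
      exact hv (funext fun i => by fin_cases i <;> assumption)
    have he : Projectivization.mk ℂ v hv = affinePoint (v 0 / v 3) (v 1 / v 3) (v 2 / v 3) := by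
      refine (Projectivization.mk_eq_mk_iff' ℂ _ _ _ _).mpr ⟨v 3, funext fun i => ?_⟩
      fin_cases i <;> simp [mul_div_cancel₀, h3]
    refine ⟨_, _, _, he, ?_⟩
    rwa [he, isSingularPoint_affinePoint] at hp

/-- The image of `(x : 0 : z : 1)` under the rotation given by the complex number `ζ`. -/
noncomputable def orbitPoint (p : ℂ × (ℂ × ℂ)) : ℙ ℂ (Fin 4 → ℂ) :=
  affinePoint (p.2.1 * (p.1 + p.1⁻¹) / 2) (p.2.1 * (p.1 - p.1⁻¹) / (2 * Complex.I)) p.2.2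

/-- The polar relations satisfied by the points of the dihedral orbit of `(x, 0)`. -/
theorem orbit_relations {ζ : ℂ} (hζ : ζ ^ 7 = 1) (x : ℂ) {a b : ℂ}
    (ha : a = x * (ζ + ζ⁻¹) / 2) (hb : b = x * (ζ - ζ⁻¹) / (2 * Complex.I)) :
    a + b * Complex.I = x * ζ ∧ a - b * Complex.I = x * ζ⁻¹ ∧ a ^ 2 + b ^ 2 = x ^ 2 ∧
    a ^ 5 - 10 * a ^ 3 * b ^ 2 + 5 * a * b ^ 4 = x ^ 3 * (a ^ 2 - b ^ 2) ∧
    5 * a ^ 4 * b - 10 * a ^ 2 * b ^ 3 + b ^ 5 = -2 * x ^ 3 * a * b ∧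
    a ^ 6 - 15 * a ^ 4 * b ^ 2 + 15 * a ^ 2 * b ^ 4 - b ^ 6 = a * x ^ 5 ∧
    6 * a ^ 5 * b - 20 * a ^ 3 * b ^ 3 + 6 * a * b ^ 5 = -b * x ^ 5 ∧
    a ^ 7 - 21 * a ^ 5 * b ^ 2 + 35 * a ^ 3 * b ^ 4 - 7 * a * b ^ 6 = x ^ 7 := by
  have h0 : ζ ≠ 0 := by
    rintro rfl
    norm_num at hζ
  have hbI : b * Complex.I = x * (ζ - ζ⁻¹) / 2 := by
    rw [hb]
    field_simp
  obtain ⟨ξ, hξ⟩ : ∃ ξ, ξ = ζ⁻¹ := ⟨_, rfl⟩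
  have h1 : ζ * ξ = 1 := by rw [hξ, mul_inv_cancel₀ h0]
  have hξ7 : ξ ^ 7 = 1 := by rw [hξ, inv_pow, hζ, inv_one]
  rw [← hξ] at ha hbI ⊢
  have hu : a + b * Complex.I = x * ζ := by rw [ha, hbI]; ring
  have hv : a - b * Complex.I = x * ξ := by rw [ha, hbI]; ring
  have hq : a ^ 2 + b ^ 2 = x ^ 2 := by
    rw [← sq_add_sq_eq, hu, hv]
    linear_combination x ^ 2 * h1
  have hb' : b = -Complex.I * (x * (ζ - ξ) / 2) := by
    rw [← hbI]
    linear_combination b * Complex.I_sq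
  have hz2 : ζ ^ 5 = ξ ^ 2 := by
    calc ζ ^ 5 = ζ ^ 5 * (ζ * ξ) ^ 2 := by rw [h1]; ring
      _ = ζ ^ 7 * ξ ^ 2 := by ring
      _ = ξ ^ 2 := by rw [hζ, one_mul]
  have hx2 : ξ ^ 5 = ζ ^ 2 := by
    calc ξ ^ 5 = ξ ^ 5 * (ζ * ξ) ^ 2 := by rw [h1]; ring
      _ = ξ ^ 7 * ζ ^ 2 := by ring
      _ = ζ ^ 2 := by rw [hξ7, one_mul]
  have hI2 : Complex.I ^ 2 = -1 := Complex.I_sq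
  have hI3 : Complex.I ^ 3 = -Complex.I := by linear_combination Complex.I * hI2
  have hI4 : Complex.I ^ 4 = 1 := Complex.I_pow_four
  have hI5 : Complex.I ^ 5 = Complex.I := by linear_combination Complex.I * hI4
  have hI6 : Complex.I ^ 6 = -1 := by linear_combination Complex.I ^ 2 * hI4 + hI2
  have hb2 : b ^ 2 = -(x * (ζ - ξ) / 2) ^ 2 := by rw [hb', mul_pow, neg_sq, hI2]; ring
  have hb3 : b ^ 3 = Complex.I * (x * (ζ - ξ) / 2) ^ 3 := by
    rw [pow_succ, hb2, hb']; ring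
  have hb4 : b ^ 4 = (x * (ζ - ξ) / 2) ^ 4 := by
    rw [show b ^ 4 = (b ^ 2) ^ 2 by ring, hb2]; ring
  have hb5 : b ^ 5 = -Complex.I * (x * (ζ - ξ) / 2) ^ 5 := by
    rw [pow_succ, hb4, hb']; ring
  have hb6 : b ^ 6 = -(x * (ζ - ξ) / 2) ^ 6 := by
    rw [show b ^ 6 = (b ^ 2) ^ 3 by ring, hb2]; ring
  have hz6 : ζ ^ 6 = ξ := by linear_combination ζ * hz2 + ξ * h1
  have hx6 : ξ ^ 6 = ζ := by linear_combination ξ * hx2 + ζ * h1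
  refine ⟨hu, hv, hq, ?_, ?_, ?_, ?_, ?_⟩
  · rw [hb2, hb4, ha]
    linear_combination x ^ 5 / 2 * (hz2 + hx2)
  · rw [hb3, hb5, hb', ha]
    linear_combination -Complex.I * x ^ 5 / 2 * (hz2 - hx2)
  · rw [hb2, hb4, hb6, ha]
    linear_combination x ^ 6 / 2 * (hz6 + hx6)
  · rw [hb3, hb5, hb', ha]
    linear_combination -Complex.I * x ^ 6 / 2 * (hz6 - hx6)
  · rw [hb2, hb4, hb6, ha]
    linear_combination x ^ 7 / 2 * (hζ + hξ7)

theorem isSingularAt_orbit {α ζ x z a b : ℂ} (hζ : ζ ^ 7 = 1) (h : IsPlaneSingular α x z)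
    (ha : a = x * (ζ + ζ⁻¹) / 2) (hb : b = x * (ζ - ζ⁻¹) / (2 * Complex.I)) :
    IsSingularAt α a b z 1 := by
  obtain ⟨-, -, hq, -, -, h6, h6', h7⟩ := orbit_relations hζ x ha hb
  obtain ⟨hZ, hW, hQ⟩ := h
  have he := axial_euler α (x ^ 2) z 1
  rw [hZ, hW] at he
  rw [IsSingularAt, h6, h6', h7, hq]
  refine ⟨?_, ?_, ?_, hZ, hW⟩
  · linear_combination x ^ 2 * hQ / 7 + he / 7
  · linear_combination a * hQ
  · linear_combination b * hQ

theorem exists_orbitPoint {α a b z : ℂ} (h : IsSingularAt α a b z 1) (h0 : a ^ 2 + b ^ 2 ≠ 0) :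
    ∃ ζ x : ℂ, ζ ^ 7 = 1 ∧ x ≠ 0 ∧ IsPlaneSingular α x z ∧
      a = x * (ζ + ζ⁻¹) / 2 ∧ b = x * (ζ - ζ⁻¹) / (2 * Complex.I) := by
  obtain ⟨hu, hv⟩ := gradient_complex h
  obtain ⟨-, -, -, hZ, hW⟩ := h
  have huv := sq_add_sq_eq a b
  obtain ⟨u, hue⟩ : ∃ u, u = a + b * Complex.I := ⟨_, rfl⟩
  obtain ⟨v, hve⟩ : ∃ v, v = a - b * Complex.I := ⟨_, rfl⟩
  rw [← hue, ← hve] at hu hv huv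
  rw [← huv] at h0 hu hv hZ hW
  have hu0 : u ≠ 0 := left_ne_zero_of_mul h0
  have hv0 : v ≠ 0 := right_ne_zero_of_mul h0
  have h7 : u ^ 7 = v ^ 7 := by linear_combination (u * hu - v * hv) / 7
  have hxq : (u ^ 4 / v ^ 3) ^ 2 = u * v := by
    field_simp
    linear_combination h7
  have hxu : u ^ 4 / v ^ 3 * (v ^ 3 / u ^ 3) = u := by
    field_simp
  have hxv : u ^ 4 / v ^ 3 * (v ^ 3 / u ^ 3)⁻¹ = v := by
    rw [inv_div]
    field_simp
    linear_combination h7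
  have hx7 : (u ^ 4 / v ^ 3) ^ 7 = u ^ 7 := by
    rw [div_pow, ← pow_mul, ← pow_mul, mul_comm 3 7, pow_mul v 7 3, ← h7]
    field_simp
  -- One needs `xζ = u` and `xζ⁻¹ = v`, so `ζ² = u/v`. As `u/v` is a seventh root of unity, its
  -- square root among those is `(u/v)⁴ = (v/u)³`.
  refine ⟨v ^ 3 / u ^ 3, u ^ 4 / v ^ 3, ?_, div_ne_zero (pow_ne_zero 4 hu0) (pow_ne_zero 3 hv0),
    ⟨by rwa [hxq], by rwa [hxq], ?_⟩, ?_, ?_⟩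
  · rw [div_pow, ← pow_mul, ← pow_mul, mul_comm 3 7, pow_mul, pow_mul, h7]
    exact div_self (pow_ne_zero 3 (pow_ne_zero 7 hv0))
  · refine mul_left_cancel₀ (pow_ne_zero 2 (div_ne_zero (pow_ne_zero 4 hu0) (pow_ne_zero 3 hv0))) ?_
    calc (u ^ 4 / v ^ 3) ^ 2 * (7 * (u ^ 4 / v ^ 3) ^ 5) = 7 * (u ^ 4 / v ^ 3) ^ 7 := by ring
      _ = (u ^ 4 / v ^ 3) ^ 2 * (2 * axialQ α ((u ^ 4 / v ^ 3) ^ 2) z 1) := by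
        rw [hx7, hxq]
        linear_combination u * hu
  · rw [mul_add, hxu, hxv, hue, hve]
    ring
  · rw [mul_sub, hxu, hxv, hue, hve]
    field_simp
    ring

/-! ### Nondegeneracy at all singular points -/

/-- The Hessian enters as a variable `M` with an equation, so that its entries can be simplified by
the orbit relations before the determinant is expanded. -/
theorem isOrdinaryDoublePoint_affinePoint {α a b z : ℂ} (h : IsSingularAt α a b z 1)
    (hdet : ∀ M : Matrix (Fin 3) (Fin 3) ℂ,
      M = !![42 * (a ^ 5 - 10 * a ^ 3 * b ^ 2 + 5 * a * b ^ 4) - 2 * axialQ α (a ^ 2 + b ^ 2) z 1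
            - 4 * a ^ 2 * axialQQ α (a ^ 2 + b ^ 2) z,
          -42 * (5 * a ^ 4 * b - 10 * a ^ 2 * b ^ 3 + b ^ 5)
            - 4 * a * b * axialQQ α (a ^ 2 + b ^ 2) z,
          -2 * a * axialQZ α (a ^ 2 + b ^ 2) z;
          -42 * (5 * a ^ 4 * b - 10 * a ^ 2 * b ^ 3 + b ^ 5)
            - 4 * a * b * axialQQ α (a ^ 2 + b ^ 2) z,
          -42 * (a ^ 5 - 10 * a ^ 3 * b ^ 2 + 5 * a * b ^ 4) - 2 * axialQ α (a ^ 2 + b ^ 2) z 1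
            - 4 * b ^ 2 * axialQQ α (a ^ 2 + b ^ 2) z,
          -2 * b * axialQZ α (a ^ 2 + b ^ 2) z;
          -2 * a * axialQZ α (a ^ 2 + b ^ 2) z, -2 * b * axialQZ α (a ^ 2 + b ^ 2) z,
          -axialZZ α (a ^ 2 + b ^ 2) z] → M.det ≠ 0) :
    IsOrdinaryDoublePoint (septic α) (affinePoint a b z) := by
  refine ⟨(isSingularPoint_affinePoint α a b z).mpr h, 3, ?_, ?_⟩
  · obtain ⟨t, ht⟩ := Projectivization.exists_smul_eq_mk_rep ℂ ![a, b, z, 1]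
      fun h => one_ne_zero (α := ℂ) (congrFun h 3)
    rw [affinePoint, ← ht]
    simp [Units.smul_def]
  · rw [affinePoint, affineCoord_mk 3 _ rfl,
      ← Matrix.det_submatrix_equiv_self (finSuccAboveEquiv (3 : Fin 4))]
    apply hdet
    have hv : ![a, b, z, 1] 3 = 1 := rfl
    ext i j
    rw [Matrix.submatrix_apply, hessianAt_dehomogenize 3 _ hv]
    fin_cases i <;> fin_cases j
    · exact eval_pderiv_zero_zero α hv
    · exact eval_pderiv_zero_one α hv
    · exact eval_pderiv_zero_two α hv
    · exact eval_pderiv_one_zero α hv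
    · exact eval_pderiv_one_one α hv
    · exact eval_pderiv_one_two α hv
    · exact eval_pderiv_two_zero α hv
    · exact eval_pderiv_two_one α hv
    · exact eval_pderiv_two_two α hv

theorem orbitPoint_isOrdinaryDoublePoint {α : ℂ} (hα : 7 * α ^ 3 + 7 * α + 1 = 0) {ζ x z : ℂ}
    (hζ : ζ ^ 7 = 1) (hx : x ≠ 0) (h : IsPlaneSingular α x z) :
    IsOrdinaryDoublePoint (septic α) (orbitPoint (ζ, x, z)) := by
  rw [orbitPoint]
  obtain ⟨a, ha⟩ : ∃ a, a = x * (ζ + ζ⁻¹) / 2 := ⟨_, rfl⟩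
  obtain ⟨b, hb⟩ : ∃ b, b = x * (ζ - ζ⁻¹) / (2 * Complex.I) := ⟨_, rfl⟩
  have hs := isSingularAt_orbit hζ h ha hb
  obtain ⟨-, -, hq, h5, h5', -, -, -⟩ := orbit_relations hζ x ha hb
  simp only
  rw [← ha, ← hb]
  refine isOrdinaryDoublePoint_affinePoint hs fun M hM => ?_
  have hH := h.planeHessian_ne_zero hα hx
  -- Powers of `x` are traded for `a² + b²`, after which the determinant formula is a polynomial
  -- identity in `a`, `b`, `x³` and the derivatives of `axial`. In the plane `y = 0` it reads `F_yy
  -- = -49x⁵` times the `xz`-minor `-x²` `planeHessian`.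
  have hx5 : 7 * x ^ 5 = 7 * x ^ 3 * (a ^ 2 + b ^ 2) := by
    rw [hq]
    ring
  have hx7 : x ^ 7 = x ^ 3 * (a ^ 2 + b ^ 2) ^ 2 := by
    rw [hq]
    ring
  rw [hq, h5, h5', ← h.2.2, hx5] at hM
  have hdet : M.det = 49 * x ^ 7 * planeHessian α x z := by
    rw [hM, Matrix.det_fin_three]
    simp only [Matrix.of_apply, Matrix.cons_val', Matrix.cons_val_zero, Matrix.cons_val_one,
      Matrix.cons_val, planeHessian, hx7]
    ring
  rw [hdet]
  exact mul_ne_zero (mul_ne_zero (by norm_num) (pow_ne_zero 7 hx)) hH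

theorem axisPoint_isOrdinaryDoublePoint {α : ℂ} (hα : 7 * α ^ 3 + 7 * α + 1 = 0) :
    IsOrdinaryDoublePoint (septic α) (affinePoint 0 0 (-1)) := by
  obtain ⟨hZ, hW⟩ := axis_isSingular hα
  have he := axial_euler α 0 (-1) 1
  rw [hZ, hW] at he
  have hq : (0 : ℂ) ^ 2 + 0 ^ 2 = 0 := by norm_num
  refine isOrdinaryDoublePoint_affinePoint ?_ fun M hM => ?_
  · rw [IsSingularAt, hq]
    refine ⟨?_, ?_, ?_, hZ, hW⟩
    · linear_combination he / 7
    · ring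
    · ring
  · have hdet : M.det = -4 * axialQ α 0 (-1) 1 ^ 2 * axialZZ α 0 (-1) := by
      rw [hM, hq, Matrix.det_fin_three]
      simp only [Matrix.of_apply, Matrix.cons_val', Matrix.cons_val_zero, Matrix.cons_val_one,
        Matrix.cons_val]
      ring
    rw [hdet]
    exact mul_ne_zero (mul_ne_zero (by norm_num) (pow_ne_zero 2 (axis_axialQ_ne_zero α)))
      (axis_axialZZ_ne_zero hα)

theorem isSingularPoint_cases {α : ℂ} (hα : 7 * α ^ 3 + 7 * α + 1 = 0) {p : ℙ ℂ (Fin 4 → ℂ)}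
    (hp : IsSingularPoint (septic α) p) :
    p = affinePoint 0 0 (-1) ∨
      ∃ ζ x z : ℂ, ζ ^ 7 = 1 ∧ x ≠ 0 ∧ IsPlaneSingular α x z ∧ p = orbitPoint (ζ, x, z) := by
  obtain ⟨a, b, z, rfl, h⟩ := exists_affinePoint hα hp
  by_cases h0 : a ^ 2 + b ^ 2 = 0
  · left
    obtain ⟨rfl, rfl⟩ := eq_zero_of_sq_add_sq h h0
    obtain ⟨-, -, -, hZ, hW⟩ := h
    rw [h0] at hZ hW
    rw [axis_singular hα hZ hW]
  · right
    obtain ⟨ζ, x, hζ, hx, hs, ha, hb⟩ := exists_orbitPoint h h0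
    exact ⟨ζ, x, z, hζ, hx, hs, by rw [ha, hb, orbitPoint]⟩

theorem isOrdinaryDoublePoint_of_isSingularPoint {α : ℂ} (hα : 7 * α ^ 3 + 7 * α + 1 = 0)
    {p : ℙ ℂ (Fin 4 → ℂ)} (hp : IsSingularPoint (septic α) p) :
    IsOrdinaryDoublePoint (septic α) p := by
  rcases isSingularPoint_cases hα hp with rfl | ⟨ζ, x, z, hζ, hx, hs, rfl⟩
  · exact axisPoint_isOrdinaryDoublePoint hα
  · exact orbitPoint_isOrdinaryDoublePoint hα hζ hx hs

/-- From `u = xζ`, `v = xζ⁻¹` and `ζ⁷ = 1` one recovers `x` by `u⁴ = x v³`, and then `ζ = u/x`. So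
each off-axis node in the plane has a full orbit of seven points, and distinct nodes have disjoint
orbits. -/
theorem orbitPoint_inj {ζ x z ζ' x' z' : ℂ} (hζ : ζ ^ 7 = 1) (hζ' : ζ' ^ 7 = 1) (hx : x ≠ 0)
    (h : orbitPoint (ζ, x, z) = orbitPoint (ζ', x', z')) : ζ = ζ' ∧ x = x' ∧ z = z' := by
  obtain ⟨ha, hb, hz⟩ := affinePoint_inj h
  simp only at ha hb hz
  obtain ⟨hu, hv, -⟩ := orbit_relations hζ x rfl rfl
  obtain ⟨hu', hv', -⟩ := orbit_relations hζ' x' rfl rfl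
  rw [ha, hb, hu'] at hu
  rw [ha, hb, hv'] at hv
  have hinv : ∀ {t : ℂ}, t ^ 7 = 1 → t * t⁻¹ = 1 := by
    intro t ht
    refine mul_inv_cancel₀ ?_
    rintro rfl
    norm_num at ht
  have key : ∀ {y t : ℂ}, t ^ 7 = 1 → (y * t) ^ 4 = y * (y * t⁻¹) ^ 3 := by
    intro y t ht
    have h1 := hinv ht
    have h3 : t⁻¹ ^ 3 = t ^ 4 := by
      calc t⁻¹ ^ 3 = t ^ 7 * t⁻¹ ^ 3 := by rw [ht, one_mul]
        _ = (t * t⁻¹) ^ 3 * t ^ 4 := by ring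
        _ = t ^ 4 := by rw [h1]; ring
    rw [mul_pow, mul_pow, h3]
    ring
  have hv0 : x * ζ⁻¹ ≠ 0 := mul_ne_zero hx (right_ne_zero_of_mul_eq_one (hinv hζ))
  have hxx : x = x' := by
    refine mul_right_cancel₀ (pow_ne_zero 3 hv0) ?_
    rw [← key hζ, ← hu, key hζ', hv]
  refine ⟨?_, hxx, hz⟩
  rw [hxx] at hu hx
  exact (mul_left_cancel₀ hx hu).symm

/-! ### The count 1 + 7 · 14 = 99, and reality of the nodes -/

theorem exists_finset_rootsOfUnity :
    ∃ s : Finset ℂ, s.card = 7 ∧ ∀ z, z ∈ s ↔ z ^ 7 = 1 := by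
  have hprim := Complex.isPrimitiveRoot_exp 7 (by norm_num)
  refine ⟨Polynomial.nthRootsFinset 7 1, hprim.card_nthRootsFinset, fun z => ?_⟩
  rw [Polynomial.mem_nthRootsFinset (by norm_num)]

theorem encard_singularPoints {α : ℂ} (hα : 7 * α ^ 3 + 7 * α + 1 = 0) :
    {p : ℙ ℂ (Fin 4 → ℂ) | IsOrdinaryDoublePoint (septic α) p}.encard = 99 := by
  classical
  obtain ⟨U, hU, hmemU⟩ := exists_finset_rootsOfUnity
  obtain ⟨S, hS, hmemS⟩ := exists_finset_planeSingular hα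
  have hset : {p : ℙ ℂ (Fin 4 → ℂ) | IsOrdinaryDoublePoint (septic α) p} =
      ((insert (affinePoint 0 0 (-1)) ((U ×ˢ S).image orbitPoint) : Finset _) : Set _) := by
    ext p
    rw [Set.mem_ofPred_eq, Finset.mem_coe, Finset.mem_insert, Finset.mem_image]
    constructor
    · intro hp
      rcases isSingularPoint_cases hα hp.1 with rfl | ⟨ζ, x, z, hζ, hx, hs, rfl⟩
      · exact Or.inl rfl
      · exact Or.inr ⟨_, Finset.mem_product.mpr
          ⟨(hmemU ζ).mpr hζ, (hmemS (x, z)).mpr ⟨hx, hs⟩⟩, rfl⟩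
    · rintro (rfl | ⟨⟨ζ, x, z⟩, h, rfl⟩)
      · exact axisPoint_isOrdinaryDoublePoint hα
      · obtain ⟨h1, h2⟩ := Finset.mem_product.mp h
        obtain ⟨hx, hs⟩ := (hmemS _).mp h2
        exact orbitPoint_isOrdinaryDoublePoint hα ((hmemU _).mp h1) hx hs
  have hnot : affinePoint 0 0 (-1) ∉ (U ×ˢ S).image orbitPoint := by
    rw [Finset.mem_image]
    rintro ⟨⟨ζ, x, z⟩, h, he⟩
    obtain ⟨h1, h2⟩ := Finset.mem_product.mp h
    obtain ⟨hx, -⟩ := (hmemS _).mp h2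
    obtain ⟨ha, hb, -⟩ := affinePoint_inj he
    obtain ⟨-, -, hq, -⟩ := orbit_relations ((hmemU _).mp h1) x rfl rfl
    simp only at ha hb
    rw [ha, hb] at hq
    -- Rotation preserves `a² + b² = x²`, which is nonzero off the axis.
    exact pow_ne_zero 2 hx (by rw [← hq]; norm_num)
  rw [hset, Set.encard_coe_eq_coe_finsetCard, Finset.card_insert_of_notMem hnot,
    Finset.card_image_of_injOn, Finset.card_product, hU, hS]
  · norm_num
  · rintro ⟨ζ, x, z⟩ h ⟨ζ', x', z'⟩ h' he
    obtain ⟨h1, h2⟩ := Finset.mem_product.mp (Finset.mem_coe.mp h)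
    obtain ⟨h1', -⟩ := Finset.mem_product.mp (Finset.mem_coe.mp h')
    obtain ⟨rfl, rfl, rfl⟩ := orbitPoint_inj ((hmemU _).mp h1) ((hmemU _).mp h1')
      ((hmemS _).mp h2).1 he
    rfl

theorem isRealPoint_affinePoint {a b z : ℂ} (ha : a.im = 0) (hb : b.im = 0) (hz : z.im = 0) :
    IsRealPoint (affinePoint a b z) := by
  have e : ![a, b, z, 1] = fun i => ((![a.re, b.re, z.re, 1] : Fin 4 → ℝ) i : ℂ) := by
    ext i
    fin_cases i
    · exact Complex.ext rfl ha
    · exact Complex.ext rfl hb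
    · exact Complex.ext rfl hz
    · exact Complex.ofReal_one.symm
  have h0 : (fun i => ((![a.re, b.re, z.re, 1] : Fin 4 → ℝ) i : ℂ)) ≠ 0 := by
    rw [← e]
    exact fun h => one_ne_zero (α := ℂ) (congrFun h 3)
  refine ⟨_, h0, ?_⟩
  simp only [affinePoint, e]

theorem isRealPoint_of_isSingularPoint {α : ℝ} (hα : 7 * α ^ 3 + 7 * α + 1 = 0)
    {p : ℙ ℂ (Fin 4 → ℂ)} (hp : IsSingularPoint (septic (α : ℂ)) p) : IsRealPoint p := by
  have hαc : 7 * (α : ℂ) ^ 3 + 7 * α + 1 = 0 := by exact_mod_cast hα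
  rcases isSingularPoint_cases hαc hp with rfl | ⟨ζ, x, z, hζ, hx, hs, rfl⟩
  · exact isRealPoint_affinePoint (by simp) (by simp) (by simp)
  · obtain ⟨hxi, hzi⟩ := isPlaneSingular_real hα hx hs
    obtain ⟨r, rfl⟩ : ∃ r : ℝ, x = r := ⟨x.re, Complex.ext rfl hxi⟩
    -- On the unit circle the inverse is the conjugate, so the rotated coordinates are `x Re ζ` and
    -- `x Im ζ`.
    have hinv : ζ⁻¹ = (starRingEnd ℂ) ζ :=
      Complex.inv_eq_conj (Complex.norm_eq_one_of_pow_eq_one hζ (by norm_num))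
    refine isRealPoint_affinePoint ?_ ?_ hzi
    · have e : (r : ℂ) * (ζ + ζ⁻¹) / 2 = ((r * ζ.re : ℝ) : ℂ) := by
        rw [hinv, Complex.add_conj]
        push_cast
        ring
      rw [e]
      exact Complex.ofReal_im _
    · have e : (r : ℂ) * (ζ - ζ⁻¹) / (2 * Complex.I) = ((r * ζ.im : ℝ) : ℂ) := by
        rw [hinv, Complex.sub_conj]
        push_cast
        field_simp
      rw [e]
      exact Complex.ofReal_im _

end LabsSeptic

theorem mainTheorem1 :
    (∀ α : ℂ, 7 * α ^ 3 + 7 * α + 1 = 0 →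
      septic α ≠ 0 ∧ (septic α).IsHomogeneous 7 ∧ IsD7Symmetric (septic α) ∧
      {p : ℙ ℂ (Fin 4 → ℂ) | IsOrdinaryDoublePoint (septic α) p}.encard = 99 ∧
      ∀ p : ℙ ℂ (Fin 4 → ℂ), IsSingularPoint (septic α) p → IsOrdinaryDoublePoint (septic α) p) ∧
    ∃ αR : ℝ, 7 * αR ^ 3 + 7 * αR + 1 = 0 ∧
      (∀ r : ℝ, 7 * r ^ 3 + 7 * r + 1 = 0 → r = αR) ∧
      |αR - (-0.14010685)| ≤ 0.000000005 ∧
      ∀ p : ℙ ℂ (Fin 4 → ℂ), IsSingularPoint (septic (αR : ℂ)) p → IsRealPoint p := by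
  refine ⟨fun α hα => ⟨LabsSeptic.septic_ne_zero α, LabsSeptic.septic_isHomogeneous α,
    LabsSeptic.septic_isD7Symmetric α, LabsSeptic.encard_singularPoints hα,
    fun p hp => LabsSeptic.isOrdinaryDoublePoint_of_isSingularPoint hα hp⟩, ?_⟩
  obtain ⟨α, hα, huniq⟩ := LabsSeptic.exists_unique_real_root
  obtain ⟨hlo, hhi⟩ := LabsSeptic.real_root_bounds hα
  refine ⟨α, hα, huniq, ?_, fun p hp => LabsSeptic.isRealPoint_of_isSingularPoint hα hp⟩
  rw [abs_le]
  constructor <;> linarith
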